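/- Let $d\ge 1$ and $\mathcal D=\{1,\dots,d\}$. For each $j\in\mathcal D$ let $\rho_j:\mathbb R\to(0,\infty)$ be a strictly positive probability density with distribution function $\Phi_j(x)=\int_{-\infty}^x\rho_j(t)\,dt$, and let $\psi_j:\mathbb R\to(0,\infty)$ be such that $\psi_j$ and $1/\psi_j$ are locally integrable. Let $\gamma_{\mathfrak u}>0$ for every $\mathfrak u\subseteq\mathcal D$. For $\mathfrak u\subseteq\mathcal D$ write $\psi_{\mathfrak u}(x_{\mathfrak u})=\prod_{j\in\mathfrak u}\psi_j(x_j)$ and $\rho_{\mathcal D\setminus\mathfrak u}(x_{\mathcal D\setminus\mathfrak u})=\prod_{j\in\mathcal D\setminus\mathfrak u}\rho_j(x_j)$, and let $\partial^{\mathfrak u}f$ denote the weak mixed derivative of $f$, i.e. the locally integrable function with $\int_{\mathbb R^d}\partial^{\mathfrak u}f\,v\,dx=(-1)^{|\mathfrak u|}\int_{\mathbb R^d}f\,\big(\prod_{j\in\mathfrak u}\tfrac{\partial}{\partial x_j}\big)v\,dx$ for all $v\in C_0^\infty(\mathbb R^d)$. Put $$\|f\|_{\mathcal H_d}^2=\sum_{\mathfrak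 u\subseteq\mathcal D}\frac1{\gamma_{\mathfrak u}}\int_{\mathbb R^d}|\partial^{\mathfrak u}f(x)|^2\,\psi_{\mathfrak u}(x_{\mathfrak u})\,\rho_{\mathcal D\setminus\mathfrak u}(x_{\mathcal D\setminus\mathfrak u})\,dx,$$ $$\|f\|_{\mathcal W_d}^2=\sum_{\mathfrak u\subseteq\mathcal D}\frac1{\gamma_{\mathfrak u}}\int_{\mathbb R^{|\mathfrak u|}}\Big|\int_{\mathbb R^{d-|\mathfrak u|}}\partial^{\mathfrak u}f(x_{\mathfrak u},x_{\mathcal D\setminus\mathfrak u})\,\rho_{\mathcal D\setminus\mathfrak u}(x_{\mathcal D\setminus\mathfrak u})\,dx_{\mathcal D\setminus\mathfrak u}\Big|^2\psi_{\mathfrak u}(x_{\mathfrak u})\,dx_{\mathfrak u}.$$ Let $\mathcal H_d$ be the set of locally integrable $f:\mathbb R^d\to\mathbb R$ whose weak derivatives $\partial^{\mathfrak u}f$ exist for all $\mathfrak u\subseteq\mathcal D$ and for which $\|f\|_{\mathcal H_d}^2<\infty$; let $\mathcal W_d$ be the set of locally integrable $f:\mathbb R^d\to\mathbb R$ whose weak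 derivatives $\partial^{\mathfrak u}f$ exist for all $\mathfrak u\subseteq\mathcal D$, for which the inner integrals in $\|f\|_{\mathcal W_d}^2$ converge absolutely for almost every $x_{\mathfrak u}$, and for which $\|f\|_{\mathcal W_d}^2<\infty$. Suppose that for every $j\in\mathcal D$ the stronger condition $$\int_{-\infty}^c\frac{\Phi_j(t)}{\psi_j(t)}\,dt<\infty\quad\text{and}\quad\int_c^\infty\frac{1-\Phi_j(t)}{\psi_j(t)}\,dt<\infty\qquad\text{for all }c\in\mathbb R$$ holds. Then $C(\rho_j,\psi_j):=\int_{-\infty}^\infty\frac{\Phi_j(t)(1-\Phi_j(t))}{\psi_j(t)}\,dt<\infty$ for every $j$, and the spaces $\mathcal H_d$ and $\mathcal W_d$ are equivalent: they consist of the same functions, and for every such $f$ $$\|f\|_{\mathcal W_d}^2\le\|f\|_{\mathcal H_d}^2\le\bigg(\max_{\mathfrak v\subseteq\mathcal D}\sum_{\mathfrak w\subseteq\mathfrak v}\frac{\gamma_{\mathfrak v}}{\gamma_{\mathfrak v\setminus\mathfrak w}}\prod_{j\in\mathfrak w}C(\rho_j,\psi_j)\bigg)\|f\|_{\mathcal W_d}^2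 .$$ In the case of product weights, i.e. $\gamma_{\mathfrak u}=\prod_{j\in\mathfrak u}\gamma_j$ for all $\mathfrak u\subseteq\mathcal D$ with some $\gamma_1,\dots,\gamma_d>0$, the constant in parentheses equals $\prod_{j=1}^d\big(1+\gamma_j\,C(\rho_j,\psi_j)\big)$. -/

import Mathlib

open MeasureTheory
open scoped ENNReal ContDiff

noncomputable section

namespace AnovaSobolev

variable {d : ℕ}

/-- Distribution function `Φ(x) = ∫_{-∞}^x ρ(t) dt` of a density `ρ`. -/
def cdf (ρ : ℝ → ℝ) (x : ℝ) : ℝ := ∫ t in Set.Iic x, ρ t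

/-- The integrand `Φ(t) (1 - Φ(t)) / ψ(t)`. -/
def embedIntegrand (ρ ψ : ℝ → ℝ) (t : ℝ) : ℝ := cdf ρ t * (1 - cdf ρ t) / ψ t

/-- `C(ρ, ψ) = ∫_{-∞}^∞ Φ(t) (1 - Φ(t)) / ψ(t) dt`. -/
def embedConst (ρ ψ : ℝ → ℝ) : ℝ := ∫ t, embedIntegrand ρ ψ t

/-- `ρ` is a strictly positive probability density on `ℝ`. -/
structure IsPosDensity (ρ : ℝ → ℝ) : Prop where
  pos : ∀ x, 0 < ρ x
  integrable : Integrable ρ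
  integral_eq_one : ∫ x, ρ x = 1

/-- `ψ` is strictly positive, and both `ψ` and `1 / ψ` are locally integrable on `ℝ`. -/
structure IsDerivWeight (ψ : ℝ → ℝ) : Prop where
  pos : ∀ x, 0 < ψ x
  locallyIntegrable : LocallyIntegrable ψ
  locallyIntegrable_inv : LocallyIntegrable fun x => 1 / ψ x

/-- The stronger condition: `∫_{-∞}^c Φ/ψ < ∞` and `∫_c^∞ (1 - Φ)/ψ < ∞` for all finite `c`. -/
def StrongerCondition (ρ ψ : ℝ → ℝ) : Prop :=
  ∀ c : ℝ, IntegrableOn (fun t => cdf ρ t / ψ t) (Set.Iic c) ∧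
    IntegrableOn (fun t => (1 - cdf ρ t) / ψ t) (Set.Ici c)

/-- Classical partial derivative `∂v/∂x_j`. -/
def partialDeriv (j : Fin d) (v : (Fin d → ℝ) → ℝ) : (Fin d → ℝ) → ℝ :=
  fun x => fderiv ℝ v x (Pi.single j 1)

/-- Classical mixed first-order partial derivative `∏_{j ∈ u} ∂/∂x_j` (one derivative in each
variable of `u`), used for smooth functions only, where the order is immaterial. -/
def mixedPartial (u : Finset (Fin d)) (v : (Fin d → ℝ) → ℝ) : (Fin d → ℝ) → ℝ :=
  (u.sort (· ≤ ·)).foldr partialDeriv v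

/-- The locally integrable function `g` is a `u`-th weak derivative of `f`. -/
def IsWeakDeriv (u : Finset (Fin d)) (f g : (Fin d → ℝ) → ℝ) : Prop :=
  LocallyIntegrable g ∧
    ∀ v : (Fin d → ℝ) → ℝ, ContDiff ℝ ∞ v → HasCompactSupport v →
      ∫ x, g x * v x = (-1) ^ u.card * ∫ x, f x * mixedPartial u v x

open Classical in
/-- The weak derivative `∂^u f`: it is unique up to a null set, and a representative is chosen
(the value is `0` if there is no weak derivative; this is never used for members of the
spaces below). -/
def weakDeriv (u : Finset (Fin d)) (f : (Fin d → ℝ) → ℝ) : (Fin d → ℝ) → ℝ :=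
  if h : ∃ g, IsWeakDeriv u f g then h.choose else 0

/-- The point `(x_u, x_{D∖u})` of `ℝ^d` with given `u`-coordinates and `D∖u`-coordinates. -/
def glue (u : Finset (Fin d)) (y : {j // j ∈ u} → ℝ) (z : {j // j ∉ u} → ℝ) : Fin d → ℝ :=
  fun j => if h : j ∈ u then y ⟨j, h⟩ else z ⟨j, h⟩

/-- The integrand `z ↦ ∂^u f(y, z) ρ_{D∖u}(z)` on `ℝ^{d-|u|}`, for `y ∈ ℝ^{|u|}`. -/
def innerIntegrand (ρ : Fin d → ℝ → ℝ) (u : Finset (Fin d)) (f : (Fin d → ℝ) → ℝ)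
    (y : {j // j ∈ u} → ℝ) (z : {j // j ∉ u} → ℝ) : ℝ :=
  weakDeriv u f (glue u y z) * ∏ j : {j // j ∉ u}, ρ j (z j)

/-- The squared Sobolev norm
`‖f‖_H² = ∑_u γ_u⁻¹ ∫_{ℝ^d} |∂^u f(x)|² ψ_u(x_u) ρ_{D∖u}(x_{D∖u}) dx`, possibly `∞`. -/
def sqNormH (ρ ψ : Fin d → ℝ → ℝ) (γ : Finset (Fin d) → ℝ) (f : (Fin d → ℝ) → ℝ) : ℝ≥0∞ :=
  ∑ u : Finset (Fin d), ENNReal.ofReal (1 / γ u) *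
    ∫⁻ x : Fin d → ℝ, ENNReal.ofReal
      (|weakDeriv u f x| ^ 2 * (∏ j ∈ u, ψ j (x j)) * ∏ j ∈ uᶜ, ρ j (x j))

/-- The squared ANOVA norm `‖f‖_W² =
∑_u γ_u⁻¹ ∫_{ℝ^{|u|}} |∫_{ℝ^{d-|u|}} ∂^u f(x_u, x_{D∖u}) ρ_{D∖u}(x_{D∖u}) dx_{D∖u}|² ψ_u(x_u) dx_u`,
possibly `∞`. -/
def sqNormW (ρ ψ : Fin d → ℝ → ℝ) (γ : Finset (Fin d) → ℝ) (f : (Fin d → ℝ) → ℝ) : ℝ≥0∞ :=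
  ∑ u : Finset (Fin d), ENNReal.ofReal (1 / γ u) *
    ∫⁻ y : {j // j ∈ u} → ℝ, ENNReal.ofReal
      (|∫ z : {j // j ∉ u} → ℝ, innerIntegrand ρ u f y z| ^ 2 * ∏ j : {j // j ∈ u}, ψ j (y j))

/-- The Sobolev space `H_d`: locally integrable functions all of whose weak derivatives `∂^u f`
exist and whose Sobolev norm is finite. (Elements are functions; the space contains with a function
every function equal to it almost everywhere.) -/
def spaceH (ρ ψ : Fin d → ℝ → ℝ) (γ : Finset (Fin d) → ℝ) : Set ((Fin d → ℝ) → ℝ) :=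
  {f | LocallyIntegrable f ∧ (∀ u, ∃ g, IsWeakDeriv u f g) ∧ sqNormH ρ ψ γ f < ⊤}

/-- The unanchored ANOVA space `W_d`: locally integrable functions all of whose weak derivatives
`∂^u f` exist, for which the inner integrals in the ANOVA norm are well defined (the integrands
are integrable for almost every `x_u`), and whose ANOVA norm is finite. -/
def spaceW (ρ ψ : Fin d → ℝ → ℝ) (γ : Finset (Fin d) → ℝ) : Set ((Fin d → ℝ) → ℝ) :=
  {f | LocallyIntegrable f ∧ (∀ u, ∃ g, IsWeakDeriv u f g) ∧
    (∀ u : Finset (Fin d), ∀ᵐ y : {j // j ∈ u} → ℝ, Integrable (innerIntegrand ρ u f y)) ∧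
    sqNormW ρ ψ γ f < ⊤}

/-- `max_{v ⊆ D} ∑_{w ⊆ v} (γ_v / γ_{v∖w}) ∏_{j ∈ w} C(ρ_j, ψ_j)`. -/
def equivConst (ρ ψ : Fin d → ℝ → ℝ) (γ : Finset (Fin d) → ℝ) : ℝ :=
  (Finset.univ : Finset (Finset (Fin d))).sup' Finset.univ_nonempty fun v =>
    ∑ w ∈ v.powerset, γ v / γ (v \ w) * ∏ j ∈ w, embedConst (ρ j) (ψ j)

end AnovaSobolev

end

/-!
Fix `f` with weak derivatives `g_v = ∂^v f`. Write `N(v, w)` (`meanSq`) for the squared norm, with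
weight `ψ_v ρ_{D∖v}`, of the average of `g_v` over the coordinates in `w ⊆ D∖v` with respect to `ρ`.
The terms of the Sobolev norm are the numbers `N(v, ∅)`, those of the ANOVA norm the numbers
`N(v, D∖v)`, so that `‖f‖_W ≤ ‖f‖_H` is Jensen's inequality.

The converse rests on a one-coordinate estimate (`meanSq_le_add`): for `j ∉ v ∪ w`,
`N(v, w) ≤ N(v, w ∪ {j}) + C(ρ_j, ψ_j) N(v ∪ {j}, w)`.
It is a weighted Poincaré inequality on the lines in direction `j`: if `G(s) - G(t) = ∫_t^s H`, then
by the Cauchy–Schwarz inequality the variance of `G` under `ρ_j`, which is half the mean of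
`|G(s) - G(t)|²` over two independent points, is at most
`½ ∬ ρ_j(s) ρ_j(t) |∫_t^s 1/ψ_j| ds dt · ∫ H² ψ_j`, and the double integral is `2 C(ρ_j, ψ_j)`,
because `τ` lies between the two points with probability `2 Φ_j(τ) (1 - Φ_j(τ))`.

Iterating over the coordinates (`meanSq_le_sum`) gives
`N(v, ∅) ≤ ∑_{s ⊆ D∖v} ∏_{j ∈ s} C(ρ_j, ψ_j) N(v ∪ s, D∖(v ∪ s))`, and summation over `v` with the
weights `1 / γ_v` produces the constant. Membership of `f` in the ANOVA space does not a priori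
allow averaging and differentiation to be interchanged. The iteration therefore descends from large
to small `v`: the interchange is needed for `g_{v ∪ {j}}` only, which is square integrable by the
induction hypothesis, while the averages of `g_v` itself exist by definition of the space.

That `g_v` is an indefinite integral of `g_{v ∪ {j}}` on almost every line in direction `j` is
proved in `ae_sub_eq_intervalIntegral_of_weak`: a test function `Ψ(r, x, y)` for the increment
`g(r, x) - g(r, y) - ∫_y^x k(r, t) dt` is turned into a test function `X(r, t)` for the weak
derivative by taking for `∂_t X` the difference of the two marginals of `Ψ`.

Averages over coordinates are written as integrals over an independent second point of `ℝ^d`, some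
of whose coordinates replace those of the first (`Finset.piecewise`), which avoids a separate space
for each set of coordinates.
-/

noncomputable section

namespace AnovaSobolev

open Set Filter Topology

/-! ### Integration by parts on the line -/

theorem locallyIntegrable_comp_fst {X Y : Type*} [TopologicalSpace X] [MeasurableSpace X]
    [TopologicalSpace Y] [MeasurableSpace Y] {μ : Measure X} {ν : Measure Y} [SFinite μ] [SFinite ν]
    [IsLocallyFiniteMeasure ν] {f : X → ℝ} (hf : LocallyIntegrable f μ) :
    LocallyIntegrable (fun z : X × Y => f z.1) (μ.prod ν) := by
  rintro ⟨x, y⟩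
  obtain ⟨U, hU, hfU⟩ := hf x
  obtain ⟨V, hV, hVf⟩ := ν.finiteAt_nhds y
  refine ⟨U ×ˢ V, prod_mem_nhds hU hV, ?_⟩
  have : IsFiniteMeasure (ν.restrict V) := ⟨by simpa using hVf⟩
  rw [IntegrableOn, ← Measure.prod_restrict]
  exact Integrable.comp_fst hfU _

theorem locallyIntegrable_comp_measurePreserving_homeomorph {X Y : Type*}
    [TopologicalSpace X] [MeasurableSpace X] [BorelSpace X]
    [TopologicalSpace Y] [MeasurableSpace Y] [BorelSpace Y] {μ : Measure X} {ν : Measure Y}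
    (e : X ≃ₜ Y) (he : MeasurePreserving e μ ν) {f : Y → ℝ} (hf : LocallyIntegrable f ν) :
    LocallyIntegrable (fun x => f (e x)) μ := by
  have := (locallyIntegrable_map_homeomorph (f := f) (μ := μ) e).1 (by rwa [he.map_eq])
  exact this

/-- Symmetrisation: testing `h` against the difference of the two marginals of `Ψ` is testing
`h(x) - h(y)` against `Ψ(x, y)`. -/
theorem integral_mul_marginal_sub {h : ℝ → ℝ} (hh : LocallyIntegrable h) {Ψ : ℝ × ℝ → ℝ}
    (hΨ : Continuous Ψ) (hc : HasCompactSupport Ψ) :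
    ∫ t, h t * ((∫ y, Ψ (t, y)) - ∫ x, Ψ (x, t)) = ∫ z : ℝ × ℝ, Ψ z * (h z.1 - h z.2) := by
  have h1 : LocallyIntegrable (fun z : ℝ × ℝ => h z.1) (volume.prod volume) :=
    locallyIntegrable_comp_fst hh
  have h2 : LocallyIntegrable (fun z : ℝ × ℝ => h z.2) (volume.prod volume) :=
    locallyIntegrable_comp_measurePreserving_homeomorph (Homeomorph.prodComm ℝ ℝ)
      Measure.measurePreserving_swap h1
  have i1 : Integrable (fun z : ℝ × ℝ => Ψ z * h z.1) (volume.prod volume) :=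
    h1.integrable_smul_left_of_hasCompactSupport hΨ hc
  have i2 : Integrable (fun z : ℝ × ℝ => Ψ z * h z.2) (volume.prod volume) :=
    h2.integrable_smul_left_of_hasCompactSupport hΨ hc
  have e1 : ∫ z : ℝ × ℝ, Ψ z * h z.1 = ∫ t, h t * ∫ y, Ψ (t, y) := by
    rw [Measure.volume_eq_prod, integral_prod _ i1]
    simp_rw [← integral_const_mul, mul_comm]
  have e2 : ∫ z : ℝ × ℝ, Ψ z * h z.2 = ∫ t, h t * ∫ x, Ψ (x, t) := by
    rw [Measure.volume_eq_prod, integral_prod_symm _ i2]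
    simp_rw [← integral_const_mul, mul_comm]
  have j1 : Integrable (fun t => h t * ∫ y, Ψ (t, y)) := by
    have := i1.integral_prod_left
    simpa only [← integral_const_mul, mul_comm] using this
  have j2 : Integrable (fun t => h t * ∫ x, Ψ (x, t)) := by
    have := i2.integral_prod_right
    simpa only [← integral_const_mul, mul_comm] using this
  simp_rw [mul_sub]
  rw [integral_sub j1 j2, ← e1, ← e2]
  exact (integral_sub i1 i2).symm

theorem intervalIntegrable_of_locallyIntegrable {k : ℝ → ℝ} (hk : LocallyIntegrable k) (a b : ℝ) :
    IntervalIntegrable k volume a b :=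
  (hk.integrableOn_isCompact isCompact_uIcc).intervalIntegrable

/-- Integration by parts on the line against the primitive of a locally integrable function. -/
theorem integral_mul_eq_neg_integral_primitive_mul {k : ℝ → ℝ} (hk : LocallyIntegrable k)
    {X : ℝ → ℝ} (hX : ContDiff ℝ 1 X) (hc : HasCompactSupport X) :
    ∫ t, k t * X t = - ∫ t, (∫ s in (0 : ℝ)..t, k s) * deriv X t := by
  obtain ⟨M, hM⟩ := hc.isCompact.isBounded.subset_closedBall 0
  set N : ℝ := |M| + 1
  have hN : tsupport X ⊆ Ioo (-N) N := by
    intro t ht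
    have := hM ht
    rw [Metric.mem_closedBall, dist_zero_right, Real.norm_eq_abs] at this
    have h2 := le_abs_self M
    exact abs_lt.1 (by grind)
  have hN0 : 0 < N := by positivity
  have z1 : ∀ t, t ∉ Ioo (-N) N → X t = 0 := fun t ht =>
    image_eq_zero_of_notMem_tsupport fun h => ht (hN h)
  have z2 : ∀ t, t ∉ Ioo (-N) N → deriv X t = 0 := fun t ht =>
    image_eq_zero_of_notMem_tsupport fun h => ht (hN (tsupport_deriv_subset h))
  have r : ∀ F : ℝ → ℝ, (∀ t, t ∉ Ioo (-N) N → F t = 0) → ∫ t, F t = ∫ t in (-N)..N, F t := by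
    intro F hF
    rw [intervalIntegral.integral_of_le (by linarith),
      setIntegral_eq_integral_of_forall_compl_eq_zero]
    exact fun t ht => hF t fun h => ht (Ioo_subset_Ioc_self h)
  have hi : ∀ a b, IntervalIntegrable k volume a b := fun a b =>
    intervalIntegrable_of_locallyIntegrable hk a b
  have ac : AbsolutelyContinuousOnInterval (fun t => ∫ s in (0 : ℝ)..t, k s) (-N) N :=
    (hi _ _).absolutelyContinuousOnInterval_intervalIntegral (by
      rw [uIcc_of_le (by linarith)]; constructor <;> linarith)
  have acX : AbsolutelyContinuousOnInterval X (-N) N := hX.contDiffOn.absolutelyContinuousOnInterval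
  have key := ac.integral_mul_deriv_eq_deriv_mul acX
  rw [r _ (fun t ht => by rw [z1 t ht, mul_zero]), r _ (fun t ht => by rw [z2 t ht, mul_zero]), key,
    z1 N (by simp), z1 (-N) (by simp)]
  simp only [mul_zero, sub_zero, zero_sub, neg_neg]
  refine intervalIntegral.integral_congr_ae ?_
  filter_upwards [LocallyIntegrable.ae_hasDerivAt_integral hk] with t ht _
  rw [(ht 0).deriv]

/-- The one-dimensional identity behind the du Bois-Reymond lemma: if the derivative of `X` is the
difference of the marginals of `Ψ`, then the failure of `k` to be the weak derivative of `g`, tested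
on `X`, is the failure of `g(x) - g(y) = ∫_y^x k`, tested on `Ψ`. -/
theorem integral_add_integral_eq_integral_increment {g k : ℝ → ℝ} (hg : LocallyIntegrable g)
    (hk : LocallyIntegrable k) {Ψ : ℝ × ℝ → ℝ} (hΨ : Continuous Ψ) (hc : HasCompactSupport Ψ)
    {X : ℝ → ℝ} (hX : ContDiff ℝ 1 X) (hcX : HasCompactSupport X)
    (hd : ∀ t, deriv X t = (∫ y, Ψ (t, y)) - ∫ x, Ψ (x, t)) :
    (∫ t, g t * deriv X t) + ∫ t, k t * X t =
      ∫ z : ℝ × ℝ, Ψ z * (g z.1 - g z.2 - ∫ t in z.2..z.1, k t) := by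
  have hKc : Continuous fun x => ∫ s in (0 : ℝ)..x, k s :=
    intervalIntegral.continuous_primitive
      (fun a b => intervalIntegrable_of_locallyIntegrable hk a b) 0
  have hdX : Continuous (deriv X) := hX.continuous_deriv (by norm_num)
  have hcd : HasCompactSupport (deriv X) := hcX.deriv
  rw [integral_mul_eq_neg_integral_primitive_mul hk hX hcX, ← sub_eq_add_neg, ← integral_sub]
  · simp_rw [← sub_mul, hd]
    rw [integral_mul_marginal_sub (h := fun t => g t - ∫ s in (0 : ℝ)..t, k s)
      (hg.sub hKc.locallyIntegrable) hΨ hc]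
    congr 1; ext z
    rw [← intervalIntegral.integral_interval_sub_left
      (intervalIntegrable_of_locallyIntegrable hk 0 z.1)
      (intervalIntegrable_of_locallyIntegrable hk 0 z.2)]
    ring
  · simpa only [smul_eq_mul, mul_comm] using hg.integrable_smul_left_of_hasCompactSupport hdX hcd
  · simpa only [smul_eq_mul, mul_comm] using
      hKc.locallyIntegrable.integrable_smul_left_of_hasCompactSupport hdX hcd

/-! ### Test functions and their marginals -/

section Smooth
variable {P : Type*} [NormedAddCommGroup P] [NormedSpace ℝ P]

theorem contDiff_integral_mul_comp_sub {Ψ : P × ℝ → ℝ} (hΨ : ContDiff ℝ ∞ Ψ)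
    (hc : HasCompactSupport Ψ) {f : ℝ → ℝ} (hf : LocallyIntegrable f) :
    ContDiff ℝ ∞ fun q : P × ℝ => ∫ τ, f τ * Ψ (q.1, q.2 - τ) := by
  have := contDiffOn_convolution_right_with_param (𝕜 := ℝ) (f := f) (μ := volume) (n := ⊤)
    (ContinuousLinearMap.mul ℝ ℝ) (g := fun (p : P) (x : ℝ) => Ψ (p, x)) (s := univ)
    (k := Prod.snd '' tsupport Ψ) isOpen_univ (hc.isCompact.image continuous_snd)
    (fun p x _ hx => image_eq_zero_of_notMem_tsupport fun h => hx ⟨_, h, rfl⟩) hf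
    (by exact hΨ.contDiffOn)
  rw [univ_prod_univ, contDiffOn_univ] at this
  exact this

theorem contDiff_integral_snd {Ψ : P × ℝ → ℝ} (hΨ : ContDiff ℝ ∞ Ψ) (hc : HasCompactSupport Ψ) :
    ContDiff ℝ ∞ fun p : P => ∫ τ, Ψ (p, τ) := by
  have h := (contDiff_integral_mul_comp_sub hΨ hc (f := fun _ => 1)
    continuous_const.locallyIntegrable).comp (contDiff_prodMk_left (0 : ℝ))
  convert h using 2 with p
  simp only [one_mul, Function.comp_def]
  exact (integral_sub_left_eq_self (fun τ => Ψ (p, τ)) volume 0).symm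

theorem contDiff_integral_Iic_snd {Ψ : P × ℝ → ℝ} (hΨ : ContDiff ℝ ∞ Ψ)
    (hc : HasCompactSupport Ψ) :
    ContDiff ℝ ∞ fun q : P × ℝ => ∫ τ in Iic q.2, Ψ (q.1, τ) := by
  have h := contDiff_integral_mul_comp_sub hΨ hc (f := (Ici (0 : ℝ)).indicator fun _ => 1)
    ((continuous_const.locallyIntegrable).indicator measurableSet_Ici)
  convert h using 2 with q
  rw [← integral_indicator measurableSet_Iic,
    ← integral_sub_left_eq_self (fun τ => (Iic q.2).indicator (fun τ => Ψ (q.1, τ)) τ) volume q.2]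
  congr 1; ext τ
  by_cases h : 0 ≤ τ <;> simp [indicator, h]

end Smooth

theorem hasDerivAt_integral_Iic {φ : ℝ → ℝ} (hφ : Continuous φ) (hi : Integrable φ) (t : ℝ) :
    HasDerivAt (fun t => ∫ τ in Iic t, φ τ) (φ t) t := by
  have h : (fun t => ∫ τ in Iic t, φ τ) =
      fun t => (∫ τ in Iic 0, φ τ) + ∫ τ in (0 : ℝ)..t, φ τ := by
    ext t
    rw [← intervalIntegral.integral_Iic_sub_Iic hi.integrableOn hi.integrableOn]; ring
  rw [h]
  exact (intervalIntegral.integral_hasDerivAt_right (hφ.intervalIntegrable _ _)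
    (hφ.stronglyMeasurableAtFilter _ _) hφ.continuousAt).const_add _

/-- The difference of the two one-dimensional marginals of a test function on `E × ℝ × ℝ`. -/
def marginalDiff {E : Type*} (Ψ : E × ℝ × ℝ → ℝ) (q : E × ℝ) : ℝ :=
  (∫ y, Ψ (q.1, q.2, y)) - ∫ x, Ψ (q.1, x, q.2)

theorem contDiff_marginalDiff {E : Type*} [NormedAddCommGroup E] [NormedSpace ℝ E]
    {Ψ : E × ℝ × ℝ → ℝ} (hΨ : ContDiff ℝ ∞ Ψ)
    (hc : HasCompactSupport Ψ) : ContDiff ℝ ∞ (marginalDiff Ψ) := by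
  refine ContDiff.sub ?_ ?_
  · have e : HasCompactSupport fun q : (E × ℝ) × ℝ => Ψ (q.1.1, q.1.2, q.2) :=
      hc.comp_homeomorph (Homeomorph.prodAssoc E ℝ ℝ)
    exact contDiff_integral_snd (Ψ := fun q : (E × ℝ) × ℝ => Ψ (q.1.1, q.1.2, q.2))
      (hΨ.comp (by fun_prop)) e
  · have e : HasCompactSupport fun q : (E × ℝ) × ℝ => Ψ (q.1.1, q.2, q.1.2) :=
      hc.comp_homeomorph ((Homeomorph.prodAssoc E ℝ ℝ).trans
        ((Homeomorph.refl E).prodCongr (Homeomorph.prodComm ℝ ℝ)))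
    exact contDiff_integral_snd (Ψ := fun q : (E × ℝ) × ℝ => Ψ (q.1.1, q.2, q.1.2))
      (hΨ.comp (by fun_prop)) e

theorem hasCompactSupport_slice {E F : Type*} [TopologicalSpace E] [TopologicalSpace F] [R1Space F]
    {Ψ : E × F → ℝ} (hc : HasCompactSupport Ψ) (r : E) : HasCompactSupport fun z => Ψ (r, z) := by
  refine HasCompactSupport.intro (hc.isCompact.image continuous_snd) fun z hz => ?_
  exact image_eq_zero_of_notMem_tsupport fun h => hz ⟨_, h, rfl⟩

/-- A compact box carrying `Ψ`. -/
theorem exists_box_of_hasCompactSupport {E : Type*} [NormedAddCommGroup E]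
    {Ψ : E × ℝ × ℝ → ℝ} (hc : HasCompactSupport Ψ) :
    ∃ (K : Set E) (M : ℝ), IsCompact K ∧ ∀ r x y, Ψ (r, x, y) ≠ 0 →
      r ∈ K ∧ x ∈ Icc (-M) M ∧ y ∈ Icc (-M) M := by
  obtain ⟨M, hM⟩ := (hc.isCompact.image continuous_snd).isBounded.subset_closedBall 0
  refine ⟨Prod.fst '' tsupport Ψ, M, hc.isCompact.image continuous_fst, fun r x y h => ?_⟩
  have ht : (r, x, y) ∈ tsupport Ψ := subset_tsupport _ h
  have h2 := hM ⟨_, ht, rfl⟩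
  rw [Metric.mem_closedBall, dist_zero_right, Prod.norm_def, sup_le_iff, Real.norm_eq_abs,
    Real.norm_eq_abs, abs_le, abs_le] at h2
  exact ⟨⟨_, ht, rfl⟩, h2.1, h2.2⟩

theorem marginalDiff_eq_zero {E : Type*} {Ψ : E × ℝ × ℝ → ℝ} {K : Set E} {M : ℝ}
    (hb : ∀ r x y, Ψ (r, x, y) ≠ 0 → r ∈ K ∧ x ∈ Icc (-M) M ∧ y ∈ Icc (-M) M)
    {q : E × ℝ} (hq : q ∉ K ×ˢ Icc (-M) M) : marginalDiff Ψ q = 0 := by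
  have h1 : ∀ y, Ψ (q.1, q.2, y) = 0 := fun y => by
    by_contra h; exact hq ⟨(hb _ _ _ h).1, (hb _ _ _ h).2.1⟩
  have h2 : ∀ x, Ψ (q.1, x, q.2) = 0 := fun x => by
    by_contra h; exact hq ⟨(hb _ _ _ h).1, (hb _ _ _ h).2.2⟩
  simp [marginalDiff, h1, h2]

theorem hasCompactSupport_marginalDiff {E : Type*} [NormedAddCommGroup E]
    {Ψ : E × ℝ × ℝ → ℝ} (hc : HasCompactSupport Ψ) :
    HasCompactSupport (marginalDiff Ψ) := by
  obtain ⟨K, M, hK, hb⟩ := exists_box_of_hasCompactSupport hc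
  exact HasCompactSupport.intro (hK.prod isCompact_Icc) fun q hq => marginalDiff_eq_zero hb hq

theorem integral_marginalDiff {E : Type*} [NormedAddCommGroup E]
    {Ψ : E × ℝ × ℝ → ℝ} (hΨ : Continuous Ψ) (hc : HasCompactSupport Ψ)
    (r : E) : ∫ t, marginalDiff Ψ (r, t) = 0 := by
  have := integral_mul_marginal_sub (h := fun _ => 1) continuous_const.locallyIntegrable
    (Ψ := fun z => Ψ (r, z)) (by fun_prop) (hasCompactSupport_slice hc r)
  simpa [marginalDiff] using this

/-- The primitive of `marginalDiff Ψ` in the last variable; it is a test function again, because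
both marginals have the same integral. -/
def marginalPrim {E : Type*} (Ψ : E × ℝ × ℝ → ℝ) (q : E × ℝ) : ℝ :=
  ∫ τ in Iic q.2, marginalDiff Ψ (q.1, τ)

theorem contDiff_marginalPrim {E : Type*} [NormedAddCommGroup E] [NormedSpace ℝ E]
    {Ψ : E × ℝ × ℝ → ℝ} (hΨ : ContDiff ℝ ∞ Ψ)
    (hc : HasCompactSupport Ψ) : ContDiff ℝ ∞ (marginalPrim Ψ) :=
  contDiff_integral_Iic_snd (contDiff_marginalDiff hΨ hc) (hasCompactSupport_marginalDiff hc)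

theorem hasCompactSupport_marginalPrim {E : Type*} [NormedAddCommGroup E]
    {Ψ : E × ℝ × ℝ → ℝ} (hΨ : Continuous Ψ)
    (hc : HasCompactSupport Ψ) : HasCompactSupport (marginalPrim Ψ) := by
  obtain ⟨K, M, hK, hb⟩ := exists_box_of_hasCompactSupport hc
  refine HasCompactSupport.intro (hK.prod (isCompact_Icc (a := -M) (b := M))) fun q hq => ?_
  by_cases hr : q.1 ∈ K
  · by_cases hM : q.2 < -M
    · refine setIntegral_eq_zero_of_forall_eq_zero fun τ hτ => marginalDiff_eq_zero hb fun h => ?_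
      have := h.2.1; have := mem_Iic.1 hτ; simp only at *; linarith
    · have hM' : M < q.2 := by
        by_contra h; exact hq ⟨hr, by constructor <;> linarith⟩
      rw [marginalPrim, setIntegral_eq_integral_of_forall_compl_eq_zero,
        integral_marginalDiff hΨ hc]
      refine fun τ hτ => marginalDiff_eq_zero hb fun h => ?_
      have := h.2.2; have := notMem_Iic.1 hτ; simp only at *; linarith
  · exact setIntegral_eq_zero_of_forall_eq_zero fun τ _ => marginalDiff_eq_zero hb fun h => hr h.1

theorem hasDerivAt_marginalPrim {E : Type*} [NormedAddCommGroup E] [NormedSpace ℝ E]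
    {Ψ : E × ℝ × ℝ → ℝ} (hΨ : ContDiff ℝ ∞ Ψ)
    (hc : HasCompactSupport Ψ) (r : E) (t : ℝ) :
    HasDerivAt (fun t => marginalPrim Ψ (r, t)) (marginalDiff Ψ (r, t)) t := by
  have hcont : Continuous fun τ => marginalDiff Ψ (r, τ) :=
    (contDiff_marginalDiff hΨ hc).continuous.comp (by fun_prop)
  refine hasDerivAt_integral_Iic hcont (hcont.integrable_of_hasCompactSupport
    (hasCompactSupport_slice (hasCompactSupport_marginalDiff hc) r)) t

/-! ### Functions with a weak derivative in one variable -/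

section
variable {E : Type*} [NormedAddCommGroup E] [ProperSpace E] [MeasurableSpace E]
  [BorelSpace E] {μ : Measure E} [SFinite μ]

theorem ae_locallyIntegrable_slice {k : E × ℝ → ℝ} (hk : LocallyIntegrable k (μ.prod volume)) :
    ∀ᵐ r ∂μ, LocallyIntegrable fun t => k (r, t) := by
  have h : ∀ n : ℕ, ∀ᵐ r ∂μ, r ∈ Metric.closedBall (0 : E) n →
      IntegrableOn (fun t => k (r, t)) (Icc (-n : ℝ) n) := by
    intro n
    have h1 := hk.integrableOn_isCompact ((isCompact_closedBall (0 : E) n).prod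
      (isCompact_Icc (a := -(n : ℝ)) (b := n)))
    rw [IntegrableOn, ← Measure.prod_restrict] at h1
    exact (ae_restrict_iff' measurableSet_closedBall).1 h1.prod_right_ae
  filter_upwards [ae_all_iff.2 h] with r hr
  rw [locallyIntegrable_iff]
  intro C hC
  obtain ⟨M, hM⟩ := hC.isBounded.subset_closedBall 0
  obtain ⟨n, hn⟩ := exists_nat_ge (max M ‖r‖)
  refine (hr n (by simpa using (le_max_right _ _).trans hn)).mono_set (hM.trans ?_)
  rw [Real.closedBall_eq_Icc]
  have := (le_max_left _ _).trans hn
  exact Icc_subset_Icc (by linarith) (by linarith)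

theorem measurable_intervalIntegral_param {α : Type*} [MeasurableSpace α] {k : α × ℝ → ℝ}
    (hk : Measurable k) {a b : α → ℝ} (ha : Measurable a) (hb : Measurable b) :
    Measurable fun r => ∫ t in a r..b r, k (r, t) := by
  have key : ∀ {a b : α → ℝ}, Measurable a → Measurable b →
      Measurable fun r => ∫ t in Ioc (a r) (b r), k (r, t) := by
    intro a b ha hb
    have hs : MeasurableSet {q : α × ℝ | a q.1 < q.2 ∧ q.2 ≤ b q.1} :=
      (measurableSet_lt (ha.comp measurable_fst) measurable_snd).inter
        (measurableSet_le measurable_snd (hb.comp measurable_fst))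
    have := ((hk.indicator hs).stronglyMeasurable.integral_prod_right' (ν := volume)).measurable
    convert this using 2 with r
    rw [← integral_indicator measurableSet_Ioc]
    rfl
  exact (key ha hb).sub (key hb ha)

theorem locallyIntegrable_primitive {k : E × ℝ → ℝ} (hkm : Measurable k)
    (hk : LocallyIntegrable k (μ.prod volume)) :
    LocallyIntegrable (fun q : E × ℝ => ∫ t in (0 : ℝ)..q.2, k (q.1, t)) (μ.prod volume) := by
  have hm : Measurable fun q : E × ℝ => ∫ t in (0 : ℝ)..q.2, k (q.1, t) :=
    measurable_intervalIntegral_param (k := fun p : (E × ℝ) × ℝ => k (p.1.1, p.2))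
      (by fun_prop) (by fun_prop) (by fun_prop)
  rintro ⟨r, x⟩
  set M : ℝ := |x| + 1
  have hMx : |x| < M := lt_add_one _
  have hM : 0 < M := by positivity
  refine ⟨Metric.closedBall r 1 ×ˢ Icc (-M) M, prod_mem_nhds (Metric.closedBall_mem_nhds _ one_pos)
    (Icc_mem_nhds (neg_lt_of_abs_lt hMx) (lt_of_abs_lt hMx)), ?_⟩
  have h1 := hk.integrableOn_isCompact ((isCompact_closedBall r 1).prod
      (isCompact_Icc (a := -M) (b := M)))
  rw [IntegrableOn, ← Measure.prod_restrict] at h1 ⊢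
  have h2 : Integrable (fun q : E × ℝ => ∫ t in Icc (-M) M, ‖k (q.1, t)‖)
      ((μ.restrict (Metric.closedBall r 1)).prod (volume.restrict (Icc (-M) M))) :=
    Integrable.comp_fst h1.norm.integral_prod_left _
  refine h2.mono' hm.aestronglyMeasurable ?_
  rw [Measure.prod_restrict]
  have h4 : ∀ᵐ q ∂((μ.restrict (Metric.closedBall r 1)).prod (volume.restrict (Icc (-M) M))),
      IntegrableOn (fun t => k (q.1, t)) (Icc (-M) M) :=
    Measure.quasiMeasurePreserving_fst.ae h1.prod_right_ae
  rw [Measure.prod_restrict] at h4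
  filter_upwards [h4, ae_restrict_mem (measurableSet_closedBall.prod measurableSet_Icc)]
    with q hi hq
  refine (intervalIntegral.norm_integral_le_integral_norm_uIoc).trans ?_
  refine setIntegral_mono_set hi.norm (ae_of_all _ fun t => norm_nonneg _) ?_
  refine LE.le.eventuallyLE (uIoc_subset_uIcc.trans (uIcc_subset_Icc ?_ hq.2))
  constructor <;> linarith

variable [NormedSpace ℝ E]

/-- A function with a locally integrable weak derivative in the last variable is, on almost every
line in that direction, an indefinite integral of the derivative. -/
theorem ae_sub_eq_intervalIntegral_of_weak {g k : E × ℝ → ℝ} (hkm : Measurable k)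
    (hg : LocallyIntegrable g (μ.prod volume)) (hk : LocallyIntegrable k (μ.prod volume))
    (hw : ∀ X : E × ℝ → ℝ, ContDiff ℝ ∞ X → HasCompactSupport X →
      (∫ q, g q * fderiv ℝ X q (0, 1) ∂μ.prod volume) + ∫ q, k q * X q ∂μ.prod volume = 0) :
    ∀ᵐ z ∂μ.prod ((volume : Measure ℝ).prod (volume : Measure ℝ)),
      g (z.1, z.2.1) - g (z.1, z.2.2) = ∫ t in z.2.2..z.2.1, k (z.1, t) := by
  have : FiniteDimensional ℝ E := FiniteDimensional.of_locallyCompactSpace ℝ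
  -- The increment of `g` minus the integral of `k` is the increment of `h`.
  set h : E × ℝ → ℝ := fun q => g q - ∫ t in (0 : ℝ)..q.2, k (q.1, t)
  have hh : LocallyIntegrable h (μ.prod volume) := hg.sub (locallyIntegrable_primitive hkm hk)
  have hh1 : LocallyIntegrable (fun z : E × ℝ × ℝ => h (z.1, z.2.1))
      (μ.prod ((volume : Measure ℝ).prod (volume : Measure ℝ))) := by
    refine locallyIntegrable_comp_measurePreserving_homeomorph (Homeomorph.prodAssoc E ℝ ℝ).symm
      ?_ (locallyIntegrable_comp_fst (ν := (volume : Measure ℝ)) hh)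
    exact (measurePreserving_prodAssoc μ volume volume).symm MeasurableEquiv.prodAssoc
  have hh2 : LocallyIntegrable (fun z : E × ℝ × ℝ => h (z.1, z.2.2))
      (μ.prod ((volume : Measure ℝ).prod (volume : Measure ℝ))) := by
    refine locallyIntegrable_comp_measurePreserving_homeomorph
      ((Homeomorph.refl E).prodCongr (Homeomorph.prodComm ℝ ℝ)) ?_ hh1
    exact (MeasurePreserving.id μ).prod Measure.measurePreserving_swap
  have hae : ∀ᵐ r ∂μ, LocallyIntegrable (fun t => g (r, t)) ∧ LocallyIntegrable fun t => k (r, t) :=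
    (ae_locallyIntegrable_slice hg).and (ae_locallyIntegrable_slice hk)
  have hinc : ∀ r, LocallyIntegrable (fun t => k (r, t)) → ∀ x y, h (r, x) - h (r, y) =
      g (r, x) - g (r, y) - ∫ t in y..x, k (r, t) := fun r hr x y => by
    rw [← intervalIntegral.integral_interval_sub_left
      (intervalIntegrable_of_locallyIntegrable hr 0 x)
      (intervalIntegrable_of_locallyIntegrable hr 0 y)]
    simp only [h]; ring
  have main := ae_eq_zero_of_integral_contDiff_smul_eq_zero (hh1.sub hh2) fun Ψ hΨ hc => by
    have iΨ : Integrable (fun z : E × ℝ × ℝ => Ψ z • (h (z.1, z.2.1) - h (z.1, z.2.2)))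
        (μ.prod (volume.prod volume)) :=
      (hh1.sub hh2).integrable_smul_left_of_hasCompactSupport hΨ.continuous hc
    -- Testing against `Ψ` reduces to the weak relation, tested on `marginalPrim Ψ`.
    have hX := contDiff_marginalPrim hΨ hc
    have hcX := hasCompactSupport_marginalPrim hΨ.continuous hc
    have hfd : ∀ r t, fderiv ℝ (marginalPrim Ψ) (r, t) (0, 1) = marginalDiff Ψ (r, t) := by
      intro r t
      have h1 := (hX.differentiable (by simp)).differentiableAt.hasFDerivAt (x := (r, t))
      have h2 : HasDerivAt (fun t : ℝ => (r, t)) ((0 : E), (1 : ℝ)) t :=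
        (hasDerivAt_const t r).prodMk (hasDerivAt_id t)
      exact (h1.comp_hasDerivAt t h2).unique (hasDerivAt_marginalPrim hΨ hc r t)
    have hd : ∀ r t, deriv (fun t => marginalPrim Ψ (r, t)) t = marginalDiff Ψ (r, t) :=
      fun r t => (hasDerivAt_marginalPrim hΨ hc r t).deriv
    have ig : Integrable (fun q => g q * fderiv ℝ (marginalPrim Ψ) q (0, 1)) (μ.prod volume) := by
      simpa only [smul_eq_mul, mul_comm] using hg.integrable_smul_left_of_hasCompactSupport
        (g := fun q => fderiv ℝ (marginalPrim Ψ) q (0, 1))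
        ((hX.continuous_fderiv (by simp)).clm_apply continuous_const) (hcX.fderiv_apply ℝ _)
    have ik : Integrable (fun q => k q * marginalPrim Ψ q) (μ.prod volume) := by
      simpa only [smul_eq_mul, mul_comm] using hk.integrable_smul_left_of_hasCompactSupport
        hX.continuous hcX
    change ∫ z, Ψ z • (h (z.1, z.2.1) - h (z.1, z.2.2)) ∂μ.prod (volume.prod volume) = 0
    rw [integral_prod _ iΨ, ← hw _ hX hcX, integral_prod _ ig, integral_prod _ ik, ← integral_add
      ig.integral_prod_left ik.integral_prod_left]
    refine integral_congr_ae ?_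
    filter_upwards [hae] with r ⟨hgr, hkr⟩
    have := integral_add_integral_eq_integral_increment hgr hkr (Ψ := fun z => Ψ (r, z))
      (hΨ.continuous.comp (by fun_prop)) (hasCompactSupport_slice hc r)
      (X := fun t => marginalPrim Ψ (r, t)) ((hX.comp (contDiff_prodMk_right r)).of_le (by simp))
      (hasCompactSupport_slice hcX r) (hd r)
    simp_rw [hd] at this
    simp_rw [hfd, this, smul_eq_mul, hinc r hkr]
    rfl
  filter_upwards [main, Measure.quasiMeasurePreserving_fst.ae hae] with z hz hr
  have := hinc z.1 hr.2 z.2.1 z.2.2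
  have h0 : h (z.1, z.2.1) - h (z.1, z.2.2) = 0 := hz
  linarith
end

/-- `ae_sub_eq_intervalIntegral_of_weak` on `ℝ^d`, along the `j`-th coordinate. The coordinate
`x j` of the base point of a line is a dummy. -/
theorem ae_update_sub_update_eq_intervalIntegral {d : ℕ} (j : Fin d) {g k : (Fin d → ℝ) → ℝ}
    (hkm : Measurable k) (hg : LocallyIntegrable g) (hk : LocallyIntegrable k)
    (hw : ∀ v : (Fin d → ℝ) → ℝ, ContDiff ℝ ∞ v → HasCompactSupport v →
      ∫ x, k x * v x = - ∫ x, g x * partialDeriv j v x) :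
    ∀ᵐ z : (Fin d → ℝ) × ℝ × ℝ,
      g (Function.update z.1 j z.2.1) - g (Function.update z.1 j z.2.2) =
        ∫ t in z.2.2..z.2.1, k (Function.update z.1 j t) := by
  obtain _ | n := d
  · exact j.elim0
  let L : (Fin (n + 1) → ℝ) →L[ℝ] (Fin n → ℝ) × ℝ :=
    (ContinuousLinearMap.pi fun i => ContinuousLinearMap.proj (j.succAbove i)).prod
      (ContinuousLinearMap.proj j)
  let e : (Fin n → ℝ) × ℝ ≃ₜ (Fin (n + 1) → ℝ) :=
    { toFun := fun q => j.insertNth q.2 q.1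
      invFun := L
      left_inv := fun q => by ext <;> simp [L]
      right_inv := fun x => by
        change j.insertNth (x j) (j.removeNth x) = x
        simp
      continuous_toFun := by fun_prop
      continuous_invFun := L.continuous }
  have he : MeasurePreserving e (volume.prod volume) volume :=
    ((volume_preserving_piFinSuccAbove (fun _ => ℝ) j).symm
      (MeasurableEquiv.piFinSuccAbove (fun _ => ℝ) j)).comp Measure.measurePreserving_swap
  have hLe : ∀ q, L (e q) = q := e.left_inv
  have hgi := locallyIntegrable_comp_measurePreserving_homeomorph e he hg
  have hki := locallyIntegrable_comp_measurePreserving_homeomorph e he hk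
  have main := ae_sub_eq_intervalIntegral_of_weak (hkm.comp e.measurable) hgi hki
    fun X hX hcX => by
      have h := hw (fun x => X (L x)) (hX.comp L.contDiff) (hcX.comp_homeomorph e.symm)
      rw [← he.integral_comp e.measurableEmbedding, ← he.integral_comp e.measurableEmbedding] at h
      have hp : ∀ q, partialDeriv j (fun x => X (L x)) (e q) = fderiv ℝ X q (0, 1) := by
        intro q
        have h1 : HasFDerivAt (fun x => X (L x)) ((fderiv ℝ X (L (e q))).comp L) (e q) :=
          ((hX.differentiable (by simp)).differentiableAt.hasFDerivAt).comp _ L.hasFDerivAt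
        rw [partialDeriv, h1.fderiv, hLe]
        have : L (Pi.single j 1) = (0, 1) := by
          ext i <;> simp [L]
        simp [this]
      simp only [hp, hLe] at h
      simp only [Function.comp_def, h, add_neg_cancel]
  have hq : Measure.QuasiMeasurePreserving
      (fun z : (Fin (n + 1) → ℝ) × ℝ × ℝ => (j.removeNth z.1, z.2)) volume
      ((volume : Measure (Fin n → ℝ)).prod ((volume : Measure ℝ).prod (volume : Measure ℝ))) := by
    refine QuasiMeasurePreserving.prodMap (f := j.removeNth) (g := id) ?_
      (Measure.QuasiMeasurePreserving.id _)
    exact Measure.quasiMeasurePreserving_snd.comp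
      (volume_preserving_piFinSuccAbove (fun _ => ℝ) j).quasiMeasurePreserving
  filter_upwards [hq.ae main] with z hz
  have hu : ∀ t, e (j.removeNth z.1, t) = Function.update z.1 j t := fun t =>
    Fin.insertNth_removeNth j t z.1
  simpa only [hu, Function.comp_def] using hz

/-! ### Product measures: densities and resampling -/

theorem aemeasurable_fintype_prod_eval {ι : Type*} [Fintype ι] {μ : ι → Measure ℝ}
    [∀ i, SigmaFinite (μ i)] {f : ι → ℝ → ℝ≥0∞} (hf : ∀ i, AEMeasurable (f i) (μ i)) :
    AEMeasurable (fun x : ι → ℝ => ∏ i, f i (x i)) (Measure.pi μ) :=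
  Finset.aemeasurable_fun_prod _ fun i _ =>
    (hf i).comp_quasiMeasurePreserving (Measure.quasiMeasurePreserving_eval μ i)

theorem lintegral_fin_prod_eval : ∀ {n : ℕ} {μ : Fin n → Measure ℝ}
    [∀ i, SigmaFinite (μ i)] {f : Fin n → ℝ → ℝ≥0∞} (_ : ∀ i, AEMeasurable (f i) (μ i)),
    ∫⁻ x, ∏ i, f i (x i) ∂Measure.pi μ = ∏ i, ∫⁻ t, f i t ∂μ i
  | 0, μ, _, f, _ => by simp
  | n + 1, μ, _, f, hf => by
    rw [← ((measurePreserving_piFinSuccAbove μ 0).symm).lintegral_comp_emb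
      (MeasurableEquiv.measurableEmbedding _), Fin.prod_univ_succ,
      ← lintegral_fin_prod_eval fun i : Fin n => hf i.succ,
      ← lintegral_prod_mul (hf 0) (aemeasurable_fintype_prod_eval fun i : Fin n => hf i.succ)]
    simp_rw [MeasurableEquiv.piFinSuccAbove_symm_apply, Fin.insertNthEquiv,
        Fin.prod_univ_succ, Fin.insertNth_zero]
    rfl

theorem lintegral_fintype_prod_eval {ι : Type*} [Fintype ι] {μ : ι → Measure ℝ}
    [∀ i, SigmaFinite (μ i)] {f : ι → ℝ → ℝ≥0∞} (hf : ∀ i, AEMeasurable (f i) (μ i)) :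
    ∫⁻ x, ∏ i, f i (x i) ∂Measure.pi μ = ∏ i, ∫⁻ t, f i t ∂μ i := by
  let e := (Fintype.equivFin ι).symm
  rw [← (measurePreserving_piCongrLeft _ e).lintegral_comp_emb
    (MeasurableEquiv.measurableEmbedding _)]
  simp_rw [← e.prod_comp, MeasurableEquiv.coe_piCongrLeft, Equiv.piCongrLeft_apply_apply]
  exact lintegral_fin_prod_eval fun i => hf _

theorem pi_withDensity_ofReal {ι : Type*} [Fintype ι] {f : ι → ℝ → ℝ}
    (hf : ∀ i, AEMeasurable (f i)) (h0 : ∀ i x, 0 ≤ f i x) :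
    Measure.pi (fun i => (volume : Measure ℝ).withDensity fun x => ENNReal.ofReal (f i x)) =
      (volume : Measure (ι → ℝ)).withDensity fun x => ENNReal.ofReal (∏ i, f i (x i)) := by
  refine Measure.pi_eq fun s hs => ?_
  rw [withDensity_apply _ (MeasurableSet.univ_pi hs), volume_pi, Measure.restrict_pi_pi]
  simp_rw [ENNReal.ofReal_prod_of_nonneg fun i _ => h0 i _]
  rw [lintegral_fintype_prod_eval (f := fun i t => ENNReal.ofReal (f i t))
    fun i => (hf i).ennreal_ofReal.restrict]
  exact Finset.prod_congr rfl fun i _ => (withDensity_apply _ (hs i)).symm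

theorem measurable_update_prod {ι : Type*} [DecidableEq ι] (j : ι) :
    Measurable fun z : (ι → ℝ) × ℝ => Function.update z.1 j z.2 := by
  refine measurable_pi_lambda _ fun i => ?_
  by_cases h : i = j
  · subst h; simpa using measurable_snd
  · simp only [h, ne_eq, not_false_eq_true, Function.update_of_ne]; fun_prop

theorem measurable_piecewise_prod {ι : Type*} [DecidableEq ι] (w : Finset ι) :
    Measurable fun z : (ι → ℝ) × (ι → ℝ) => w.piecewise z.2 z.1 := by
  refine measurable_pi_lambda _ fun i => ?_
  by_cases h : i ∈ w
  · simp only [h, Finset.piecewise_eq_of_mem]; fun_prop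
  · simp only [h, not_false_eq_true, Finset.piecewise_eq_of_notMem]; fun_prop

section Pi
variable {ι : Type*} [Fintype ι] [DecidableEq ι] (μ ν : ι → Measure ℝ) [∀ i, SigmaFinite (μ i)]
  [∀ i, SigmaFinite (ν i)]

/-- Resampling coordinates: if the coordinates that are thrown away carry probability measures,
then taking the coordinates in `w` from an independent second point maps product measure to
product measure. -/
theorem measurePreserving_piecewise (w : Finset ι) (hμ : ∀ i ∈ w, IsProbabilityMeasure (μ i))
    (hν : ∀ i ∉ w, IsProbabilityMeasure (ν i)) :
    MeasurePreserving (fun z : (ι → ℝ) × (ι → ℝ) => w.piecewise z.2 z.1)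
      ((Measure.pi μ).prod (Measure.pi ν)) (Measure.pi (w.piecewise ν μ)) := by
  have : ∀ i, SigmaFinite ((w.piecewise ν μ) i) := fun i => by
    by_cases h : i ∈ w <;> simp only [h, Finset.piecewise_eq_of_mem, Finset.piecewise_eq_of_notMem,
      not_false_eq_true] <;> infer_instance
  refine ⟨measurable_piecewise_prod w, (Measure.pi_eq fun s hs => ?_).symm⟩
  rw [Measure.map_apply (measurable_piecewise_prod w) (MeasurableSet.univ_pi hs)]
  have : (fun z : (ι → ℝ) × (ι → ℝ) => w.piecewise z.2 z.1) ⁻¹' (univ.pi s) =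
      (univ.pi fun i => if i ∈ w then univ else s i) ×ˢ
        (univ.pi fun i => if i ∈ w then s i else univ) := by
    ext z
    simp only [mem_preimage, mem_univ_pi, mem_prod, ← forall_and]
    refine forall_congr' fun i => ?_
    by_cases h : i ∈ w <;> simp [h]
  rw [this, Measure.prod_prod, Measure.pi_pi, Measure.pi_pi, ← Finset.prod_mul_distrib]
  refine Finset.prod_congr rfl fun i _ => ?_
  by_cases h : i ∈ w
  · have := hμ i h; simp [h]
  · have := hν i h; simp [h]

theorem measurePreserving_update (j : ι) [IsProbabilityMeasure (μ j)] (κ : Measure ℝ)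
    [SigmaFinite κ] :
    MeasurePreserving (fun z : (ι → ℝ) × ℝ => Function.update z.1 j z.2)
      ((Measure.pi μ).prod κ) (Measure.pi (Function.update μ j κ)) := by
  have : ∀ i, SigmaFinite (Function.update μ j κ i) := fun i => by
    by_cases h : i = j
    · subst h; simpa
    · simp only [ne_eq, h, not_false_eq_true, Function.update_of_ne]; infer_instance
  refine ⟨measurable_update_prod j, (Measure.pi_eq fun s hs => ?_).symm⟩
  rw [Measure.map_apply (measurable_update_prod j) (MeasurableSet.univ_pi hs)]
  have : (fun z : (ι → ℝ) × ℝ => Function.update z.1 j z.2) ⁻¹' (univ.pi s) =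
      (univ.pi (Function.update s j univ)) ×ˢ s j := by
    ext z
    simp only [mem_preimage, mem_univ_pi, mem_prod]
    constructor
    · refine fun h => ⟨fun i => ?_, by simpa using h j⟩
      by_cases hi : i = j
      · subst hi; simp
      · simpa [hi] using h i
    · rintro ⟨h, hj⟩ i
      by_cases hi : i = j
      · subst hi; simpa
      · simpa [hi] using h i
  rw [this, Measure.prod_prod, Measure.pi_pi, ← Finset.mul_prod_erase _ _ (Finset.mem_univ j),
    ← Finset.mul_prod_erase _ (fun i => (Function.update μ j κ i) (s i)) (Finset.mem_univ j)]
  simp only [Function.update_self, measure_univ, one_mul]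
  rw [mul_comm]
  congr 1
  refine Finset.prod_congr rfl fun i hi => ?_
  simp [Finset.ne_of_mem_erase hi]

end Pi

theorem measurePreserving_subtype_restrict {ι : Type*} [Fintype ι] (μ : ι → Measure ℝ)
    [∀ i, SigmaFinite (μ i)] (p : ι → Prop) [DecidablePred p]
    (hμ : ∀ i, ¬ p i → IsProbabilityMeasure (μ i)) :
    MeasurePreserving (fun (x : ι → ℝ) (i : {i // p i}) => x i) (Measure.pi μ)
      (Measure.pi fun i : {i // p i} => μ i) := by
  have hp : ∀ i : {i // ¬ p i}, IsProbabilityMeasure (μ i) := fun i => hμ i i.2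
  exact measurePreserving_fst.comp (measurePreserving_piEquivPiSubtypeProd μ p)

/-! ### A weighted Poincaré inequality on the line -/

theorem lintegral_mul_sq_le {α : Type*} [MeasurableSpace α] {μ : Measure α} {f g : α → ℝ≥0∞}
    (hf : AEMeasurable f μ) (hg : AEMeasurable g μ) :
    (∫⁻ a, f a * g a ∂μ) ^ 2 ≤ (∫⁻ a, f a ^ 2 ∂μ) * ∫⁻ a, g a ^ 2 ∂μ := by
  have h := ENNReal.lintegral_mul_le_Lp_mul_Lq μ Real.HolderConjugate.two_two hf hg
  have h2 : ∀ x : ℝ≥0∞, (x ^ (1 / (2 : ℝ))) ^ 2 = x := fun x => by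
    rw [← ENNReal.rpow_natCast, ← ENNReal.rpow_mul]; norm_num
  calc _ ≤ _ := pow_le_pow_left' h 2
    _ = _ := by
      rw [mul_pow, h2, h2]
      simp_rw [ENNReal.rpow_two]

theorem ofReal_sq_eq_enorm_sq (x : ℝ) : ENNReal.ofReal (x ^ 2) = ‖x‖ₑ ^ 2 := by
  rw [← sq_abs, ENNReal.ofReal_pow (abs_nonneg x), Real.enorm_eq_ofReal_abs]

/-- The measure on the line with density `ρ`; negative values of `ρ` count as `0`. -/
def densityMeasure (ρ : ℝ → ℝ) : Measure ℝ := volume.withDensity fun x => ENNReal.ofReal (ρ x)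

instance (ρ : ℝ → ℝ) : SigmaFinite (densityMeasure ρ) := SigmaFinite.withDensity_ofReal ρ

theorem densityMeasure_absolutelyContinuous (ρ : ℝ → ℝ) : densityMeasure ρ ≪ volume :=
  withDensity_absolutelyContinuous _ _

namespace IsDerivWeight
variable {ψ : ℝ → ℝ} (hψ : IsDerivWeight ψ)
include hψ

theorem aemeasurable : AEMeasurable ψ := hψ.locallyIntegrable.aestronglyMeasurable.aemeasurable

theorem aemeasurable_inv : AEMeasurable fun x => 1 / ψ x :=
  hψ.locallyIntegrable_inv.aestronglyMeasurable.aemeasurable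

theorem lintegral_densityMeasure (f : ℝ → ℝ≥0∞) :
    ∫⁻ t, f t ∂densityMeasure ψ = ∫⁻ t, ENNReal.ofReal (ψ t) * f t := by
  rw [densityMeasure, lintegral_withDensity_eq_lintegral_mul_non_measurable₀ _
    hψ.aemeasurable.ennreal_ofReal (ae_of_all _ fun x => ENNReal.ofReal_lt_top)]
  rfl

/-- The Cauchy–Schwarz inequality with weights `1 / ψ` and `ψ`. -/
theorem setLIntegral_enorm_sq_le {H : ℝ → ℝ} (hH : Measurable H) (S : Set ℝ) :
    (∫⁻ t in S, ‖H t‖ₑ) ^ 2 ≤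
      (∫⁻ t in S, ENNReal.ofReal (1 / ψ t)) * ∫⁻ t, ‖H t‖ₑ ^ 2 ∂densityMeasure ψ := by
  have h1 : ∀ t, ‖H t‖ₑ = ENNReal.ofReal √(1 / ψ t) * ENNReal.ofReal (√(ψ t) * |H t|) := by
    intro t
    rw [← ENNReal.ofReal_mul (by positivity), ← mul_assoc, ← Real.sqrt_mul (by
      have := hψ.pos t; positivity), one_div_mul_cancel (hψ.pos t).ne', Real.sqrt_one, one_mul,
      Real.enorm_eq_ofReal_abs]
  simp_rw [h1]
  refine (lintegral_mul_sq_le ?_ ?_).trans ?_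
  · exact (hψ.aemeasurable_inv.sqrt.ennreal_ofReal).restrict
  · exact ((hψ.aemeasurable.sqrt.mul (by fun_prop)).ennreal_ofReal).restrict
  refine mul_le_mul' (le_of_eq ?_) ?_
  · congr 1; ext t
    rw [← ENNReal.ofReal_pow (by positivity), Real.sq_sqrt (by have := hψ.pos t; positivity)]
  · rw [hψ.lintegral_densityMeasure]
    refine (setLIntegral_le_lintegral _ _).trans (lintegral_mono fun t => le_of_eq ?_)
    rw [← h1, ← ofReal_sq_eq_enorm_sq, ← ENNReal.ofReal_mul (hψ.pos t).le,
      ← ENNReal.ofReal_pow (by positivity), mul_pow, Real.sq_sqrt (hψ.pos t).le, sq_abs]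

theorem setLIntegral_uIoc_inv_lt_top (a b : ℝ) :
    ∫⁻ t in uIoc a b, ENNReal.ofReal (1 / ψ t) < ⊤ := by
  exact ((hψ.locallyIntegrable_inv.integrableOn_isCompact
    (isCompact_uIcc (a := a) (b := b))).mono_set uIoc_subset_uIcc).lintegral_lt_top

end IsDerivWeight

namespace IsPosDensity
variable {ρ : ℝ → ℝ} (hρ : IsPosDensity ρ)
include hρ

theorem isProbabilityMeasure : IsProbabilityMeasure (densityMeasure ρ) := ⟨by
  rw [densityMeasure, withDensity_apply _ MeasurableSet.univ, setLIntegral_univ,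
    ← ofReal_integral_eq_lintegral_ofReal hρ.integrable (ae_of_all _ fun x => (hρ.pos x).le),
    hρ.integral_eq_one, ENNReal.ofReal_one]⟩

theorem densityMeasure_Iio (x : ℝ) : densityMeasure ρ (Iio x) = ENNReal.ofReal (cdf ρ x) := by
  rw [densityMeasure, withDensity_apply _ measurableSet_Iio, setLIntegral_congr Iio_ae_eq_Iic, cdf,
    ofReal_integral_eq_lintegral_ofReal hρ.integrable.integrableOn
      (ae_of_all _ fun x => (hρ.pos x).le)]

theorem cdf_add_integral_Ioi (x : ℝ) : cdf ρ x + ∫ t in Ioi x, ρ t = 1 := by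
  rw [cdf, ← compl_Iic, integral_add_compl measurableSet_Iic hρ.integrable, hρ.integral_eq_one]

theorem densityMeasure_Ici (x : ℝ) : densityMeasure ρ (Ici x) = ENNReal.ofReal (1 - cdf ρ x) := by
  rw [← hρ.cdf_add_integral_Ioi x, add_sub_cancel_left, densityMeasure,
    withDensity_apply _ measurableSet_Ici, ← setLIntegral_congr Ioi_ae_eq_Ici,
    ofReal_integral_eq_lintegral_ofReal hρ.integrable.integrableOn
      (ae_of_all _ fun x => (hρ.pos x).le)]

theorem cdf_nonneg (x : ℝ) : 0 ≤ cdf ρ x := integral_nonneg fun t => (hρ.pos t).le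

theorem cdf_le_one (x : ℝ) : cdf ρ x ≤ 1 := by
  have := hρ.cdf_add_integral_Ioi x
  have h2 : 0 ≤ ∫ t in Ioi x, ρ t := integral_nonneg fun t => (hρ.pos t).le
  linarith

theorem monotone_cdf : Monotone (cdf ρ) := fun _ _ h =>
  setIntegral_mono_set hρ.integrable.integrableOn (ae_of_all _ fun t => (hρ.pos t).le)
    (LE.le.eventuallyLE (Iic_subset_Iic.2 h))

theorem embedIntegrand_nonneg {ψ : ℝ → ℝ} (hψ : IsDerivWeight ψ) (t : ℝ) :
    0 ≤ embedIntegrand ρ ψ t :=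
  div_nonneg (mul_nonneg (hρ.cdf_nonneg t) (sub_nonneg.2 (hρ.cdf_le_one t))) (hψ.pos t).le

theorem embedConst_nonneg {ψ : ℝ → ℝ} (hψ : IsDerivWeight ψ) : 0 ≤ embedConst ρ ψ :=
  integral_nonneg (hρ.embedIntegrand_nonneg hψ)

theorem integrable_embedIntegrand {ψ : ℝ → ℝ} (hψ : IsDerivWeight ψ) (hs : StrongerCondition ρ ψ) :
    Integrable (embedIntegrand ρ ψ) := by
  have hm : AEStronglyMeasurable (embedIntegrand ρ ψ) := by
    have h1 := hρ.monotone_cdf.measurable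
    have : embedIntegrand ρ ψ = fun t => cdf ρ t * (1 - cdf ρ t) * (1 / ψ t) := by
      ext t; rw [embedIntegrand]; ring
    rw [this]
    exact ((by fun_prop : Measurable fun t => cdf ρ t * (1 - cdf ρ t)).aemeasurable.mul
      hψ.aemeasurable_inv).aestronglyMeasurable
  rw [← integrableOn_univ, ← Iic_union_Ici (a := (0 : ℝ))]
  refine IntegrableOn.union ((hs 0).1.mono' hm.restrict (ae_of_all _ fun t => ?_))
    ((hs 0).2.mono' hm.restrict (ae_of_all _ fun t => ?_))
  all_goals
    rw [Real.norm_of_nonneg (hρ.embedIntegrand_nonneg hψ t), embedIntegrand]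
    have := hψ.pos t
    have := hρ.cdf_nonneg t
    have := hρ.cdf_le_one t
    gcongr
    nlinarith

/-- Two independent points with density `ρ` have the point `t` between them with probability
`2 Φ(t) (1 - Φ(t))`; integrating over `t` against `1 / ψ` gives the embedding constant. -/
theorem lintegral_prod_setLIntegral_uIoc {ψ : ℝ → ℝ} (hψ : IsDerivWeight ψ)
    (hs : StrongerCondition ρ ψ) :
    ∫⁻ p : ℝ × ℝ, (∫⁻ t in uIoc p.2 p.1, ENNReal.ofReal (1 / ψ t))
      ∂(densityMeasure ρ).prod (densityMeasure ρ) = 2 * ENNReal.ofReal (embedConst ρ ψ) := by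
  set B : Set ((ℝ × ℝ) × ℝ) := {q | q.2 ∈ uIoc q.1.2 q.1.1}
  have hB : MeasurableSet B := by
    have : B = {q | min q.1.2 q.1.1 < q.2} ∩ {q | q.2 ≤ max q.1.2 q.1.1} := rfl
    rw [this]
    exact (measurableSet_lt (by fun_prop) (by fun_prop)).inter
      (measurableSet_le (by fun_prop) (by fun_prop))
  have h1 : ∀ p : ℝ × ℝ, ∫⁻ t in uIoc p.2 p.1, ENNReal.ofReal (1 / ψ t) =
      ∫⁻ t, B.indicator 1 (p, t) * ENNReal.ofReal (1 / ψ t) := fun p => by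
    rw [← lintegral_indicator measurableSet_uIoc]
    congr 1; ext t
    by_cases h : t ∈ uIoc p.2 p.1
    · have : (p, t) ∈ B := h
      simp [h, this]
    · have : (p, t) ∉ B := h
      simp [h, this]
  have h2 : ∀ t, ∫⁻ p, B.indicator 1 (p, t) ∂(densityMeasure ρ).prod (densityMeasure ρ) =
      2 * ENNReal.ofReal (cdf ρ t * (1 - cdf ρ t)) := fun t => by
    have e : (fun p : ℝ × ℝ => B.indicator (1 : (ℝ × ℝ) × ℝ → ℝ≥0∞) (p, t)) =
        ((Ici t ×ˢ Iio t) ∪ (Iio t ×ˢ Ici t)).indicator 1 := by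
      ext p
      have : (p, t) ∈ B ↔ p ∈ (Ici t ×ˢ Iio t) ∪ (Iio t ×ˢ Ici t) := by
        change t ∈ uIoc p.2 p.1 ↔ _
        simp only [mem_uIoc, mem_union, mem_prod, mem_Ici, mem_Iio]
        tauto
      by_cases h : p ∈ (Ici t ×ˢ Iio t) ∪ (Iio t ×ˢ Ici t)
      · simp [h, this.2 h]
      · simp [h, mt this.1 h]
    rw [e, lintegral_indicator_one ((measurableSet_Ici.prod measurableSet_Iio).union
        (measurableSet_Iio.prod measurableSet_Ici)),
      measure_union _ (measurableSet_Iio.prod measurableSet_Ici),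
      Measure.prod_prod, Measure.prod_prod, hρ.densityMeasure_Iio, hρ.densityMeasure_Ici,
      ENNReal.ofReal_mul (hρ.cdf_nonneg t)]
    · ring
    · rw [Set.disjoint_left]
      rintro p ⟨h, _⟩ ⟨h', _⟩
      exact not_le.2 (mem_Iio.1 h') (mem_Ici.1 h)
  simp_rw [h1]
  rw [lintegral_lintegral_swap]
  · have h3 : ∀ t, ∫⁻ p, B.indicator 1 (p, t) * ENNReal.ofReal (1 / ψ t)
        ∂(densityMeasure ρ).prod (densityMeasure ρ) =
        2 * ENNReal.ofReal (embedIntegrand ρ ψ t) := fun t => by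
      rw [lintegral_mul_const' _ _ ENNReal.ofReal_ne_top, h2, mul_assoc, ← ENNReal.ofReal_mul
        (mul_nonneg (hρ.cdf_nonneg t) (sub_nonneg.2 (hρ.cdf_le_one t))), embedIntegrand,
        mul_one_div]
    simp_rw [h3]
    rw [lintegral_const_mul' _ _ (by simp), embedConst, ofReal_integral_eq_lintegral_ofReal
      (hρ.integrable_embedIntegrand hψ hs) (ae_of_all _ (hρ.embedIntegrand_nonneg hψ))]
  · refine AEMeasurable.mul (measurable_one.indicator hB).aemeasurable ?_
    exact (hψ.aemeasurable_inv.ennreal_ofReal).comp_quasiMeasurePreserving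
      Measure.quasiMeasurePreserving_snd

end IsPosDensity

theorem memLp_two_iff_lintegral_enorm_sq {α : Type*} [MeasurableSpace α] {μ : Measure α}
    {G : α → ℝ} (hG : AEStronglyMeasurable G μ) :
    MemLp G 2 μ ↔ ∫⁻ a, ‖G a‖ₑ ^ 2 ∂μ < ⊤ := by
  rw [MemLp, and_iff_right hG, eLpNorm_lt_top_iff_lintegral_rpow_enorm_lt_top (by simp) (by simp)]
  simp

theorem ofReal_integral_sq {α : Type*} [MeasurableSpace α] {μ : Measure α}
    {G : α → ℝ} (hG : MemLp G 2 μ) :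
    ENNReal.ofReal (∫ a, G a ^ 2 ∂μ) = ∫⁻ a, ‖G a‖ₑ ^ 2 ∂μ := by
  rw [ofReal_integral_eq_lintegral_ofReal hG.integrable_sq (ae_of_all _ fun x => sq_nonneg _)]
  simp_rw [ofReal_sq_eq_enorm_sq]

/-- The second moment is the squared mean plus half the mean squared difference of two
independent copies. -/
theorem two_mul_lintegral_enorm_sq_eq {m : Measure ℝ} [IsProbabilityMeasure m] {G : ℝ → ℝ}
    (hG : AEStronglyMeasurable G m)
    (hD : ∫⁻ p, ‖G p.1 - G p.2‖ₑ ^ 2 ∂m.prod m ≠ ⊤) :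
    2 * ∫⁻ s, ‖G s‖ₑ ^ 2 ∂m =
      2 * ‖∫ s, G s ∂m‖ₑ ^ 2 + ∫⁻ p, ‖G p.1 - G p.2‖ₑ ^ 2 ∂m.prod m := by
  have hGp : AEStronglyMeasurable (fun p : ℝ × ℝ => G p.1 - G p.2) (m.prod m) :=
    hG.comp_fst.sub hG.comp_snd
  have hL2 : MemLp G 2 m := by
    -- For almost every `t` the function `G - G t` is square integrable, hence so is `G`.
    have hD' := hD
    rw [lintegral_prod_symm _ (hGp.enorm.pow_const 2)] at hD'
    obtain ⟨t, ht⟩ := (ae_lt_top' ((hGp.enorm.pow_const 2).lintegral_prod_left') hD').exists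
    have h1 : MemLp (fun s => G s - G t) 2 m :=
      (memLp_two_iff_lintegral_enorm_sq (hG.sub aestronglyMeasurable_const)).2 ht
    exact (h1.add (memLp_const (G t))).congr_norm hG (ae_of_all _ fun s => by simp)
  have hi := hL2.integrable one_le_two
  have hD2 : MemLp (fun p : ℝ × ℝ => G p.1 - G p.2) 2 (m.prod m) :=
    (memLp_two_iff_lintegral_enorm_sq hGp).2 hD.lt_top
  rw [← ofReal_integral_sq hL2, ← ofReal_integral_sq hD2, ← ofReal_sq_eq_enorm_sq]
  have e : ∫ p : ℝ × ℝ, (G p.1 - G p.2) ^ 2 ∂m.prod m =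
      2 * ∫ s, G s ^ 2 ∂m - 2 * (∫ s, G s ∂m) ^ 2 := by
    have i1 : Integrable (fun p : ℝ × ℝ => G p.1 ^ 2) (m.prod m) := hL2.integrable_sq.comp_fst m
    have i2 : Integrable (fun p : ℝ × ℝ => G p.2 ^ 2) (m.prod m) := hL2.integrable_sq.comp_snd m
    have i3 : Integrable (fun p : ℝ × ℝ => 2 * (G p.1 * G p.2)) (m.prod m) :=
      (hi.mul_prod hi).const_mul 2
    have : ∀ p : ℝ × ℝ, (G p.1 - G p.2) ^ 2 = G p.1 ^ 2 + G p.2 ^ 2 - 2 * (G p.1 * G p.2) :=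
      fun p => by ring
    simp_rw [this]
    refine (integral_sub (i1.add i2) i3).trans ?_
    rw [integral_add' i1 i2, integral_const_mul, integral_prod_mul G G,
      integral_fun_fst (fun s => G s ^ 2), integral_fun_snd (fun s => G s ^ 2)]
    simp only [probReal_univ, one_smul]
    ring
  rw [e, ← ENNReal.ofReal_ofNat 2, ← ENNReal.ofReal_mul (by norm_num),
    ← ENNReal.ofReal_mul (by norm_num), ← ENNReal.ofReal_add (by positivity)]
  · congr 1; ring
  · rw [← e]; exact integral_nonneg fun p => sq_nonneg _

/-- The weighted Poincaré inequality on the line: the variance of `G` with respect to `ρ` is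
at most `C(ρ, ψ)` times the squared norm of its derivative `H` in `L²(ψ)`. -/
theorem lintegral_enorm_sq_le_of_increment {ρ ψ : ℝ → ℝ} (hρ : IsPosDensity ρ)
    (hψ : IsDerivWeight ψ) (hs : StrongerCondition ρ ψ) {G H : ℝ → ℝ}
    (hG : AEStronglyMeasurable G (densityMeasure ρ)) (hH : Measurable H)
    (hA : ∫⁻ t, ‖H t‖ₑ ^ 2 ∂densityMeasure ψ ≠ ⊤)
    (hinc : ∀ᵐ p ∂(densityMeasure ρ).prod (densityMeasure ρ),
      G p.1 - G p.2 = ∫ t in p.2..p.1, H t) :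
    ∫⁻ s, ‖G s‖ₑ ^ 2 ∂densityMeasure ρ ≤ ‖∫ s, G s ∂densityMeasure ρ‖ₑ ^ 2 +
      ENNReal.ofReal (embedConst ρ ψ) * ∫⁻ t, ‖H t‖ₑ ^ 2 ∂densityMeasure ψ := by
  have := hρ.isProbabilityMeasure
  have hD : ∫⁻ p, ‖G p.1 - G p.2‖ₑ ^ 2 ∂(densityMeasure ρ).prod (densityMeasure ρ) ≤
      2 * ENNReal.ofReal (embedConst ρ ψ) * ∫⁻ t, ‖H t‖ₑ ^ 2 ∂densityMeasure ψ := by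
    rw [← hρ.lintegral_prod_setLIntegral_uIoc hψ hs, ← lintegral_mul_const' _ _ hA]
    refine lintegral_mono_ae ?_
    filter_upwards [hinc] with p hp
    rw [hp]
    refine le_trans (pow_le_pow_left' ?_ 2) (hψ.setLIntegral_enorm_sq_le hH _)
    calc ‖∫ t in p.2..p.1, H t‖ₑ = ‖∫ t in uIoc p.2 p.1, H t‖ₑ := by
          rw [← ofReal_norm, ← ofReal_norm, intervalIntegral.norm_intervalIntegral_eq]
      _ ≤ _ := enorm_integral_le_lintegral_enorm _
  have hne : ∫⁻ p, ‖G p.1 - G p.2‖ₑ ^ 2 ∂(densityMeasure ρ).prod (densityMeasure ρ) ≠ ⊤ :=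
    ne_top_of_le_ne_top (ENNReal.mul_ne_top (by finiteness) hA) hD
  have h2 := two_mul_lintegral_enorm_sq_eq hG hne
  have h3 : 2 * ∫⁻ s, ‖G s‖ₑ ^ 2 ∂densityMeasure ρ ≤ 2 * (‖∫ s, G s ∂densityMeasure ρ‖ₑ ^ 2 +
      ENNReal.ofReal (embedConst ρ ψ) * ∫⁻ t, ‖H t‖ₑ ^ 2 ∂densityMeasure ψ) := by
    rw [h2, mul_add, ← mul_assoc 2 (ENNReal.ofReal _)]
    gcongr
  exact (ENNReal.mul_le_mul_iff_right (by simp) (by simp)).1 h3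

/-! ### Iterated weak derivatives -/

theorem contDiff_partialDeriv {d : ℕ} (j : Fin d) {v : (Fin d → ℝ) → ℝ} (hv : ContDiff ℝ ∞ v) :
    ContDiff ℝ ∞ (partialDeriv j v) :=
  (hv.fderiv_right (by simp)).clm_apply contDiff_const

theorem hasCompactSupport_partialDeriv {d : ℕ} (j : Fin d) {v : (Fin d → ℝ) → ℝ}
    (hv : HasCompactSupport v) : HasCompactSupport (partialDeriv j v) :=
  hv.fderiv_apply ℝ _

theorem partialDeriv_comm {d : ℕ} (i j : Fin d) {v : (Fin d → ℝ) → ℝ} (hv : ContDiff ℝ ∞ v) :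
    partialDeriv i (partialDeriv j v) = partialDeriv j (partialDeriv i v) := by
  have h : ∀ (a b : Fin d) x, partialDeriv a (partialDeriv b v) x =
      fderiv ℝ (fderiv ℝ v) x (Pi.single a 1) (Pi.single b 1) := fun a b x => by
    have h1 : DifferentiableAt ℝ (fderiv ℝ v) x :=
      ((hv.fderiv_right (m := ∞) (by simp)).differentiable (by simp)).differentiableAt
    have h2 := h1.hasFDerivAt.clm_apply (hasFDerivAt_const (Pi.single b (1 : ℝ)) x)
    rw [partialDeriv, show partialDeriv b v = fun y => fderiv ℝ v y (Pi.single b 1) from rfl,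
      h2.fderiv]
    simp
  ext x
  rw [h, h]
  exact (hv.contDiffAt.isSymmSndFDerivAt (by
    rw [minSmoothness_of_isRCLikeNormedField]; exact WithTop.coe_le_coe.2 le_top)).eq _ _

theorem contDiff_foldr_partialDeriv {d : ℕ} (l : List (Fin d)) {v : (Fin d → ℝ) → ℝ}
    (hv : ContDiff ℝ ∞ v) : ContDiff ℝ ∞ (l.foldr partialDeriv v) := by
  induction l with
  | nil => exact hv
  | cons a l ih => exact contDiff_partialDeriv a ih

theorem foldr_partialDeriv_perm {d : ℕ} {l₁ l₂ : List (Fin d)} (h : l₁.Perm l₂)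
    {v : (Fin d → ℝ) → ℝ} (hv : ContDiff ℝ ∞ v) :
    l₁.foldr partialDeriv v = l₂.foldr partialDeriv v := by
  induction h with
  | nil => rfl
  | cons a _ ih => rw [List.foldr_cons, List.foldr_cons, ih]
  | swap a b l => exact partialDeriv_comm _ _ (contDiff_foldr_partialDeriv l hv)
  | trans _ _ h1 h2 => exact h1.trans h2

theorem mixedPartial_insert {d : ℕ} {u : Finset (Fin d)} {j : Fin d} (hj : j ∉ u)
    {v : (Fin d → ℝ) → ℝ} (hv : ContDiff ℝ ∞ v) :
    mixedPartial (insert j u) v = mixedPartial u (partialDeriv j v) := by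
  have hp : ((insert j u).sort (· ≤ ·)).Perm (u.sort (· ≤ ·) ++ [j]) := by
    rw [← Multiset.coe_eq_coe, Finset.sort_eq, ← Multiset.coe_add, Finset.sort_eq,
      Finset.insert_val_of_notMem hj, ← Multiset.singleton_add, add_comm]
    rfl
  rw [mixedPartial, foldr_partialDeriv_perm hp hv, List.foldr_append]
  rfl

/-- Weak mixed derivatives are iterated weak derivatives: the `insert j u`-th one is the weak
partial derivative in direction `j` of the `u`-th one. -/
theorem IsWeakDeriv.integral_mul_eq_neg {d : ℕ} {u : Finset (Fin d)} {j : Fin d} (hj : j ∉ u)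
    {f g k : (Fin d → ℝ) → ℝ} (hg : IsWeakDeriv u f g) (hk : IsWeakDeriv (insert j u) f k)
    {v : (Fin d → ℝ) → ℝ} (hv : ContDiff ℝ ∞ v) (hc : HasCompactSupport v) :
    ∫ x, k x * v x = - ∫ x, g x * partialDeriv j v x := by
  rw [hk.2 v hv hc, hg.2 _ (contDiff_partialDeriv j hv) (hasCompactSupport_partialDeriv j hc),
    mixedPartial_insert hj hv, Finset.card_insert_of_notMem hj, pow_succ]
  ring

theorem IsWeakDeriv.congr_ae {d : ℕ} {u : Finset (Fin d)} {f g g' : (Fin d → ℝ) → ℝ}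
    (hg : IsWeakDeriv u f g) (h : g =ᵐ[volume] g') : IsWeakDeriv u f g' := by
  refine ⟨fun x => ?_, fun v hv hc => ?_⟩
  · obtain ⟨s, hs, hi⟩ := hg.1 x
    exact ⟨s, hs, IntegrableOn.congr_fun_ae hi (ae_restrict_of_ae h)⟩
  · rw [← hg.2 v hv hc]
    refine integral_congr_ae ?_
    filter_upwards [h] with x hx
    rw [hx]

theorem isWeakDeriv_weakDeriv {d : ℕ} {u : Finset (Fin d)} {f : (Fin d → ℝ) → ℝ}
    (h : ∃ g, IsWeakDeriv u f g) : IsWeakDeriv u f (weakDeriv u f) := by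
  rw [weakDeriv, dif_pos h]
  exact h.choose_spec

/-! ### Partial averages -/

/-- The product measure on `ℝ^d` with density `ψ_v(x_v) ρ_{D∖v}(x_{D∖v})`. -/
def mixedMeasure {d : ℕ} (ρ ψ : Fin d → ℝ → ℝ) (v : Finset (Fin d)) : Measure (Fin d → ℝ) :=
  Measure.pi fun j => densityMeasure (if j ∈ v then ψ j else ρ j)

instance {d : ℕ} (ρ ψ : Fin d → ℝ → ℝ) (v : Finset (Fin d)) : SigmaFinite (mixedMeasure ρ ψ v) := by
  unfold mixedMeasure; infer_instance

/-- Averaging over the coordinates in `w` with respect to `ρ`, as an operator on functions on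
`ℝ^d`; the average is taken over a full independent copy of the point, of which only the coordinates
in `w` matter. Its law `mixedMeasure ρ ψ ∅` is the product of the densities `ρ_j` and does not
involve `ψ`. -/
def partialMean {d : ℕ} (ρ ψ : Fin d → ℝ → ℝ) (w : Finset (Fin d)) (g : (Fin d → ℝ) → ℝ)
    (x : Fin d → ℝ) : ℝ :=
  ∫ y, g (w.piecewise y x) ∂mixedMeasure ρ ψ ∅

/-- The squared norm, with weight `ψ_v ρ_{D∖v}`, of the average of `g` over the coordinates
in `w`. -/
def meanSq {d : ℕ} (ρ ψ : Fin d → ℝ → ℝ) (v w : Finset (Fin d)) (g : (Fin d → ℝ) → ℝ) : ℝ≥0∞ :=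
  ∫⁻ x, ‖partialMean ρ ψ w g x‖ₑ ^ 2 ∂mixedMeasure ρ ψ v

theorem piecewise_update_right {d : ℕ} {w : Finset (Fin d)} {j : Fin d} (hj : j ∉ w)
    (y x : Fin d → ℝ) (s : ℝ) :
    w.piecewise y (Function.update x j s) = Function.update (w.piecewise y x) j s :=
  (w.update_piecewise_of_notMem y x hj s).symm

theorem piecewise_insert_update {d : ℕ} {w : Finset (Fin d)} {j : Fin d} (hj : j ∉ w)
    (y x : Fin d → ℝ) (s : ℝ) :
    (insert j w).piecewise (Function.update y j s) x = Function.update (w.piecewise y x) j s := by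
  ext i
  by_cases h : i = j
  · subst h; simp
  · by_cases hi : i ∈ w <;> simp [Finset.piecewise, h, hi]

section
variable {d : ℕ} {ρ ψ : Fin d → ℝ → ℝ}

theorem measurable_partialMean {w : Finset (Fin d)} {g : (Fin d → ℝ) → ℝ} (hg : Measurable g) :
    Measurable (partialMean ρ ψ w g) :=
  ((hg.comp (measurable_piecewise_prod w)).stronglyMeasurable.integral_prod_right').measurable

variable (hρ : ∀ j, IsPosDensity (ρ j))
include hρ

theorem isProbabilityMeasure_mixedMeasure_empty : IsProbabilityMeasure (mixedMeasure ρ ψ ∅) := by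
  have : ∀ j : Fin d, IsProbabilityMeasure (densityMeasure (if j ∈ (∅ : Finset (Fin d)) then ψ j
    else ρ j)) := fun j => by simpa using (hρ j).isProbabilityMeasure
  unfold mixedMeasure; infer_instance

theorem measurePreserving_piecewise_mixed {v w : Finset (Fin d)} (hvw : Disjoint w v) :
    MeasurePreserving (fun z : (Fin d → ℝ) × (Fin d → ℝ) => w.piecewise z.2 z.1)
      ((mixedMeasure ρ ψ v).prod (mixedMeasure ρ ψ ∅)) (mixedMeasure ρ ψ v) := by
  have h := measurePreserving_piecewise (fun j => densityMeasure (if j ∈ v then ψ j else ρ j))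
    (fun j => densityMeasure (if j ∈ (∅ : Finset (Fin d)) then ψ j else ρ j)) w
    (fun j hj => by
      have := Finset.disjoint_left.1 hvw hj
      simpa [this] using (hρ j).isProbabilityMeasure)
    (fun j _ => by simpa using (hρ j).isProbabilityMeasure)
  have e : w.piecewise (fun j => densityMeasure (if j ∈ (∅ : Finset (Fin d)) then ψ j else ρ j))
      (fun j => densityMeasure (if j ∈ v then ψ j else ρ j)) =
      fun i => densityMeasure (if i ∈ v then ψ i else ρ i) := by
    funext j
    by_cases hj : j ∈ w
    · simp [hj, Finset.disjoint_left.1 hvw hj]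
    · simp [hj]
  rw [e] at h
  exact h

theorem measurePreserving_update_mixed {v : Finset (Fin d)} {j : Fin d} (hj : j ∉ v) :
    MeasurePreserving (fun z : (Fin d → ℝ) × ℝ => Function.update z.1 j z.2)
      ((mixedMeasure ρ ψ v).prod (densityMeasure (ρ j))) (mixedMeasure ρ ψ v) := by
  have : IsProbabilityMeasure (densityMeasure (if j ∈ v then ψ j else ρ j)) := by
    simpa [hj] using (hρ j).isProbabilityMeasure
  have h := measurePreserving_update (fun j => densityMeasure (if j ∈ v then ψ j else ρ j)) j
    (densityMeasure (ρ j))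
  have e : Function.update (fun j => densityMeasure (if j ∈ v then ψ j else ρ j)) j
      (densityMeasure (ρ j)) =
      fun i => densityMeasure (if i ∈ v then ψ i else ρ i) := by
    funext i
    by_cases hi : i = j
    · subst hi; simp [hj]
    · simp [hi]
  rw [e] at h
  exact h

theorem measurePreserving_update_mixed_insert {v : Finset (Fin d)} {j : Fin d} (hj : j ∉ v) :
    MeasurePreserving (fun z : (Fin d → ℝ) × ℝ => Function.update z.1 j z.2)
      ((mixedMeasure ρ ψ v).prod (densityMeasure (ψ j))) (mixedMeasure ρ ψ (insert j v)) := by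
  have : IsProbabilityMeasure (densityMeasure (if j ∈ v then ψ j else ρ j)) := by
    simpa [hj] using (hρ j).isProbabilityMeasure
  have h := measurePreserving_update (fun j => densityMeasure (if j ∈ v then ψ j else ρ j)) j
    (densityMeasure (ψ j))
  have e : Function.update (fun j => densityMeasure (if j ∈ v then ψ j else ρ j)) j
      (densityMeasure (ψ j)) =
      fun i => densityMeasure (if i ∈ insert j v then ψ i else ρ i) := by
    funext i
    by_cases hi : i = j
    · subst hi; simp
    · simp [hi]
  rw [e] at h
  exact h

/-- Jensen's inequality: averaging does not increase the norm. -/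
theorem meanSq_le {v w : Finset (Fin d)} (hvw : Disjoint w v) {g : (Fin d → ℝ) → ℝ}
    (hg : Measurable g) :
    meanSq ρ ψ v w g ≤ ∫⁻ x, ‖g x‖ₑ ^ 2 ∂mixedMeasure ρ ψ v := by
  have := isProbabilityMeasure_mixedMeasure_empty (ψ := ψ) hρ
  have hm : Measurable fun x => ‖g x‖ₑ ^ 2 := hg.enorm.pow_const 2
  rw [← (measurePreserving_piecewise_mixed hρ hvw).lintegral_comp hm]
  refine le_trans ?_ (lintegral_prod _ (hm.comp (measurable_piecewise_prod w)).aemeasurable).ge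
  refine lintegral_mono fun x => ?_
  refine (pow_le_pow_left' (enorm_integral_le_lintegral_enorm _) 2).trans ?_
  have hgx : Measurable fun y => ‖g (w.piecewise y x)‖ₑ :=
    (hg.comp ((measurable_piecewise_prod w).comp measurable_prodMk_left)).enorm
  have := lintegral_mul_sq_le (μ := mixedMeasure ρ ψ ∅) (f := fun _ => 1) (g := fun y =>
    ‖g (w.piecewise y x)‖ₑ) aemeasurable_const hgx.aemeasurable
  simpa using this

/-- If `g` is averaged absolutely over all coordinates outside `v`, then it is so over any subset
of them. -/
theorem ae_integrable_piecewise_of_compl {v w : Finset (Fin d)} (hvw : Disjoint w v)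
    {g : (Fin d → ℝ) → ℝ} (hg : Measurable g)
    (h : ∀ᵐ x ∂mixedMeasure ρ ψ v,
      Integrable (fun y => g (vᶜ.piecewise y x)) (mixedMeasure ρ ψ ∅)) :
    ∀ᵐ x ∂mixedMeasure ρ ψ v, Integrable (fun y => g (w.piecewise y x)) (mixedMeasure ρ ψ ∅) := by
  have hcomp : Disjoint vᶜ v := disjoint_compl_left
  have hS : MeasurableSet {x | Integrable (fun y => g (w.piecewise y x)) (mixedMeasure ρ ψ ∅)} :=
    measurableSet_integrable (hg.comp (measurable_piecewise_prod w)).stronglyMeasurable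
  have hmp := measurePreserving_piecewise_mixed (ψ := ψ) hρ hcomp
  rw [← hmp.map_eq, ae_map_iff hmp.measurable.aemeasurable hS]
  have hP : MeasurableSet {z : (Fin d → ℝ) × (Fin d → ℝ) |
      Integrable (fun y => g (w.piecewise y (vᶜ.piecewise z.2 z.1))) (mixedMeasure ρ ψ ∅)} :=
    hS.preimage hmp.measurable
  refine (Measure.ae_prod_iff_ae_ae hP).2 ?_
  filter_upwards [h] with x hx
  have h0 := measurePreserving_piecewise_mixed (ψ := ψ) hρ (Finset.disjoint_empty_right w)
  have h1 := (h0.integrable_comp hx.aestronglyMeasurable).2 hx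
  filter_upwards [h1.prod_right_ae] with y hy
  convert hy using 2 with y'
  simp only [Function.comp]
  congr 1
  ext i
  by_cases hi : i ∈ w
  · simp [hi, Finset.disjoint_left.1 hvw hi]
  · by_cases hv : i ∈ v <;> simp [hi, hv]

end

theorem mixedMeasure_eq_withDensity {d : ℕ} {ρ ψ : Fin d → ℝ → ℝ} (hρ : ∀ j, IsPosDensity (ρ j))
    (hψ : ∀ j, IsDerivWeight (ψ j)) (v : Finset (Fin d)) :
    mixedMeasure ρ ψ v = volume.withDensity fun x =>
      ENNReal.ofReal ((∏ j ∈ v, ψ j (x j)) * ∏ j ∈ vᶜ, ρ j (x j)) := by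
  have h := pi_withDensity_ofReal (f := fun j => if j ∈ v then ψ j else ρ j)
    (fun j => by
      by_cases hj : j ∈ v
      · simpa [hj] using (hψ j).aemeasurable
      · simpa [hj] using (hρ j).integrable.aestronglyMeasurable.aemeasurable)
    (fun j x => by
      by_cases hj : j ∈ v
      · simpa [hj] using ((hψ j).pos x).le
      · simpa [hj] using ((hρ j).pos x).le)
  refine h.trans ?_
  congr 1; ext1 x
  congr 1
  rw [← Finset.prod_mul_prod_compl v]
  congr 1
  · exact Finset.prod_congr rfl fun j hj => by simp [hj]
  · exact Finset.prod_congr rfl fun j hj => by simp [Finset.mem_compl.1 hj]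

theorem mixedMeasure_absolutelyContinuous {d : ℕ} {ρ ψ : Fin d → ℝ → ℝ}
    (hρ : ∀ j, IsPosDensity (ρ j)) (hψ : ∀ j, IsDerivWeight (ψ j)) (v : Finset (Fin d)) :
    mixedMeasure ρ ψ v ≪ volume := by
  rw [mixedMeasure_eq_withDensity hρ hψ]
  exact withDensity_absolutelyContinuous _ _

/-! ### Averaging over one more coordinate -/

section
variable {d : ℕ} {ρ ψ : Fin d → ℝ → ℝ}

/-- Averaging commutes with integrating along a line outside the averaged coordinates. -/
theorem partialMean_update_sub_eq {w : Finset (Fin d)} {j : Fin d} (hj : j ∉ w)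
    {g k : (Fin d → ℝ) → ℝ} (x : Fin d → ℝ) (s t : ℝ)
    (hs : Integrable (fun y => g (Function.update (w.piecewise y x) j s)) (mixedMeasure ρ ψ ∅))
    (ht : Integrable (fun y => g (Function.update (w.piecewise y x) j t)) (mixedMeasure ρ ψ ∅))
    (hk : Integrable (fun z : (Fin d → ℝ) × ℝ => k (Function.update (w.piecewise z.1 x) j z.2))
      ((mixedMeasure ρ ψ ∅).prod (volume.restrict (uIoc t s))))
    (hinc : ∀ᵐ y ∂mixedMeasure ρ ψ ∅, g (Function.update (w.piecewise y x) j s) -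
      g (Function.update (w.piecewise y x) j t) =
        ∫ τ in t..s, k (Function.update (w.piecewise y x) j τ)) :
    partialMean ρ ψ w g (Function.update x j s) - partialMean ρ ψ w g (Function.update x j t) =
      ∫ τ in t..s, partialMean ρ ψ w k (Function.update x j τ) := by
  simp only [partialMean, piecewise_update_right hj]
  rw [← integral_sub hs ht, integral_congr_ae hinc]
  simp only [intervalIntegral.intervalIntegral_eq_integral_uIoc]
  rw [integral_smul, integral_integral_swap hk]

variable (hρ : ∀ j, IsPosDensity (ρ j)) (hψ : ∀ j, IsDerivWeight (ψ j))
include hρ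

theorem meanSq_eq_lintegral_update {v w : Finset (Fin d)} {j : Fin d} (hj : j ∉ v)
    {g : (Fin d → ℝ) → ℝ} (hg : Measurable g) :
    meanSq ρ ψ v w g = ∫⁻ x, (∫⁻ s, ‖partialMean ρ ψ w g (Function.update x j s)‖ₑ ^ 2
      ∂densityMeasure (ρ j)) ∂mixedMeasure ρ ψ v := by
  have hm : Measurable fun x => ‖partialMean ρ ψ w g x‖ₑ ^ 2 :=
    (measurable_partialMean hg).enorm.pow_const 2
  rw [meanSq, ← (measurePreserving_update_mixed hρ hj).lintegral_comp hm]
  exact lintegral_prod _ (hm.comp (measurable_update_prod j)).aemeasurable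

theorem meanSq_insert_eq_lintegral_update {v w : Finset (Fin d)} {j : Fin d} (hj : j ∉ v)
    {g : (Fin d → ℝ) → ℝ} (hg : Measurable g) :
    meanSq ρ ψ (insert j v) w g = ∫⁻ x, (∫⁻ s, ‖partialMean ρ ψ w g (Function.update x j s)‖ₑ ^ 2
      ∂densityMeasure (ψ j)) ∂mixedMeasure ρ ψ v := by
  have hm : Measurable fun x => ‖partialMean ρ ψ w g x‖ₑ ^ 2 :=
    (measurable_partialMean hg).enorm.pow_const 2
  rw [meanSq, ← (measurePreserving_update_mixed_insert hρ hj).lintegral_comp hm]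
  exact lintegral_prod _ (hm.comp (measurable_update_prod j)).aemeasurable

/-- Averaging over the coordinates in `insert j w` is averaging over those in `w` and then over the
`j`-th one. -/
theorem partialMean_insert {w : Finset (Fin d)} {j : Fin d} (hj : j ∉ w)
    {g : (Fin d → ℝ) → ℝ} {x : Fin d → ℝ}
    (h : Integrable (fun y => g ((insert j w).piecewise y x)) (mixedMeasure ρ ψ ∅)) :
    Integrable (fun z : (Fin d → ℝ) × ℝ => g (Function.update (w.piecewise z.1 x) j z.2))
      ((mixedMeasure ρ ψ ∅).prod (densityMeasure (ρ j))) ∧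
    ∫ s, partialMean ρ ψ w g (Function.update x j s) ∂densityMeasure (ρ j) =
      partialMean ρ ψ (insert j w) g x := by
  have hmp := measurePreserving_update_mixed (ψ := ψ) hρ (Finset.notMem_empty j)
  have h1 := (hmp.integrable_comp h.aestronglyMeasurable).2 h
  simp only [Function.comp_def, piecewise_insert_update hj] at h1
  refine ⟨h1, ?_⟩
  simp only [partialMean, piecewise_update_right hj]
  have e := integral_map hmp.measurable.aemeasurable (f := fun y => g ((insert j w).piecewise y x))
    (by rw [hmp.map_eq]; exact h.aestronglyMeasurable)
  rw [hmp.map_eq] at e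
  rw [← integral_prod_symm _ h1, e]
  simp only [piecewise_insert_update hj]

include hψ

/-- The derivative `k`, being square integrable, is integrable on almost every strip spanned by an
interval in direction `j` and the averaged coordinates. -/
theorem ae_integrable_strip {v w : Finset (Fin d)} {j : Fin d} (hjv : j ∉ v) (hwv : Disjoint w v)
    {k : (Fin d → ℝ) → ℝ} (hk : Measurable k)
    (hk2 : ∫⁻ x, ‖k x‖ₑ ^ 2 ∂mixedMeasure ρ ψ (insert j v) ≠ ⊤) :
    ∀ᵐ x ∂mixedMeasure ρ ψ v, ∀ a b : ℝ,
      Integrable (fun z : (Fin d → ℝ) × ℝ => k (Function.update (w.piecewise z.1 x) j z.2))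
        ((mixedMeasure ρ ψ ∅).prod (volume.restrict (uIoc a b))) := by
  have := isProbabilityMeasure_mixedMeasure_empty (ψ := ψ) hρ
  have hm : Measurable fun x => ‖k x‖ₑ ^ 2 := hk.enorm.pow_const 2
  have hm1 : Measurable fun z : (Fin d → ℝ) × ℝ => ‖k (Function.update z.1 j z.2)‖ₑ ^ 2 :=
    hm.comp (measurable_update_prod j)
  have hm2 : Measurable fun x => ∫⁻ s, ‖k (Function.update x j s)‖ₑ ^ 2 ∂densityMeasure (ψ j) :=
    hm1.lintegral_prod_right'
  have e : ∫⁻ x, ‖k x‖ₑ ^ 2 ∂mixedMeasure ρ ψ (insert j v) =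
      ∫⁻ x, (∫⁻ y, (∫⁻ s, ‖k (Function.update (w.piecewise y x) j s)‖ₑ ^ 2
        ∂densityMeasure (ψ j)) ∂mixedMeasure ρ ψ ∅) ∂mixedMeasure ρ ψ v := by
    rw [← (measurePreserving_update_mixed_insert hρ hjv).lintegral_comp hm]
    refine (lintegral_prod _ hm1.aemeasurable).trans ?_
    rw [← (measurePreserving_piecewise_mixed hρ hwv).lintegral_comp hm2]
    exact lintegral_prod _ (hm2.comp (measurable_piecewise_prod w)).aemeasurable
  rw [e] at hk2
  have hm3 : Measurable fun z : (Fin d → ℝ) × (Fin d → ℝ) =>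
      ∫⁻ s, ‖k (Function.update (w.piecewise z.2 z.1) j s)‖ₑ ^ 2 ∂densityMeasure (ψ j) :=
    hm2.comp (measurable_piecewise_prod w)
  filter_upwards [ae_lt_top hm3.lintegral_prod_right' hk2] with x hx a b
  have hkx : Measurable fun z : (Fin d → ℝ) × ℝ => k (Function.update (w.piecewise z.1 x) j z.2) :=
    hk.comp ((measurable_update_prod j).comp ((((measurable_piecewise_prod w).comp
      (measurable_const.prodMk measurable_id)).comp measurable_fst).prodMk measurable_snd))
  refine ⟨hkx.aestronglyMeasurable, ?_⟩
  rw [HasFiniteIntegral, lintegral_prod _ hkx.enorm.aemeasurable]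
  -- On each line Cauchy–Schwarz bounds the square of the integral, and `a ≤ 1 + a ^ 2`.
  have hle : ∀ y, ∫⁻ τ in uIoc a b, ‖k (Function.update (w.piecewise y x) j τ)‖ₑ ≤
      1 + (∫⁻ t in uIoc a b, ENNReal.ofReal (1 / ψ j t)) *
        ∫⁻ s, ‖k (Function.update (w.piecewise y x) j s)‖ₑ ^ 2 ∂densityMeasure (ψ j) := fun y => by
    have hsq : ∀ A : ℝ≥0∞, A ≤ 1 + A ^ 2 := fun A => by
      rcases le_total A 1 with h | h
      · exact h.trans le_self_add
      · exact (le_self_pow h two_ne_zero).trans le_add_self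
    exact (hsq _).trans (add_le_add_right ((hψ j).setLIntegral_enorm_sq_le
      (hk.comp (measurable_update _)) _) 1)
  refine (lintegral_mono hle).trans_lt ?_
  rw [lintegral_add_left measurable_const, lintegral_const_mul' _ _
    ((hψ j).setLIntegral_uIoc_inv_lt_top a b).ne]
  refine ENNReal.add_lt_top.2 ⟨by simp, ENNReal.mul_lt_top
    ((hψ j).setLIntegral_uIoc_inv_lt_top a b) hx⟩

/-- Along almost every line in direction `j`, the average of `g` over the coordinates in `w` is an
indefinite integral of the average of its weak derivative `k`. -/
theorem ae_partialMean_increment {v w : Finset (Fin d)} {j : Fin d} (hjv : j ∉ v) (hjw : j ∉ w)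
    (hwv : Disjoint w v) {g k : (Fin d → ℝ) → ℝ} (hk : Measurable k)
    (hline : ∀ᵐ z : (Fin d → ℝ) × ℝ × ℝ,
      g (Function.update z.1 j z.2.1) - g (Function.update z.1 j z.2.2) =
        ∫ t in z.2.2..z.2.1, k (Function.update z.1 j t))
    (hint : ∀ᵐ x ∂mixedMeasure ρ ψ v,
      Integrable (fun y => g ((insert j w).piecewise y x)) (mixedMeasure ρ ψ ∅))
    (hk2 : ∫⁻ x, ‖k x‖ₑ ^ 2 ∂mixedMeasure ρ ψ (insert j v) ≠ ⊤) :
    ∀ᵐ x ∂mixedMeasure ρ ψ v, ∀ᵐ p ∂(densityMeasure (ρ j)).prod (densityMeasure (ρ j)),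
      partialMean ρ ψ w g (Function.update x j p.1) -
        partialMean ρ ψ w g (Function.update x j p.2) =
        ∫ τ in p.2..p.1, partialMean ρ ψ w k (Function.update x j τ) := by
  -- A resampled point with two independent line parameters has a law with a Lebesgue density, so
  -- the relation between `g` and `k` holds almost surely for it.
  have hq : Measure.QuasiMeasurePreserving
      (fun q : (Fin d → ℝ) × (ℝ × ℝ) × (Fin d → ℝ) => (w.piecewise q.2.2 q.1, q.2.1))
      ((mixedMeasure ρ ψ v).prod (((densityMeasure (ρ j)).prod (densityMeasure (ρ j))).prod
        (mixedMeasure ρ ψ ∅))) volume := by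
    have h1 : Measure.QuasiMeasurePreserving
        (fun z : (Fin d → ℝ) × (Fin d → ℝ) => w.piecewise z.2 z.1)
        ((mixedMeasure ρ ψ v).prod (mixedMeasure ρ ψ ∅)) volume :=
      (measurePreserving_piecewise_mixed hρ hwv).quasiMeasurePreserving.mono_right
        (mixedMeasure_absolutelyContinuous hρ hψ v)
    have h2 : Measure.QuasiMeasurePreserving (id : ℝ × ℝ → ℝ × ℝ)
        ((densityMeasure (ρ j)).prod (densityMeasure (ρ j))) volume :=
      (Measure.QuasiMeasurePreserving.id _).mono_left
        ((densityMeasure_absolutelyContinuous _).prod (densityMeasure_absolutelyContinuous _))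
    have h3 := (measurePreserving_prodAssoc (mixedMeasure ρ ψ v) (mixedMeasure ρ ψ ∅)
      ((densityMeasure (ρ j)).prod (densityMeasure (ρ j)))).symm MeasurableEquiv.prodAssoc
    have h4 := (MeasurePreserving.id (mixedMeasure ρ ψ v)).prod (Measure.measurePreserving_swap
      (μ := (densityMeasure (ρ j)).prod (densityMeasure (ρ j))) (ν := mixedMeasure ρ ψ ∅))
    exact (QuasiMeasurePreserving.prodMap h1 h2).comp (h3.comp h4).quasiMeasurePreserving
  filter_upwards [Measure.ae_ae_of_ae_prod (hq.ae hline), hint,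
    ae_integrable_strip hρ hψ hjv hwv hk hk2] with x hx hix hkx
  have hsl : ∀ᵐ s ∂densityMeasure (ρ j), Integrable
      (fun y => g (Function.update (w.piecewise y x) j s)) (mixedMeasure ρ ψ ∅) :=
    (partialMean_insert hρ hjw hix).1.prod_left_ae
  filter_upwards [Measure.ae_ae_of_ae_prod hx, Measure.quasiMeasurePreserving_fst.ae hsl,
    Measure.quasiMeasurePreserving_snd.ae hsl] with p hp h1 h2
  exact partialMean_update_sub_eq hjw x p.1 p.2 h1 h2 (hkx _ _) hp

/-- Averaging over one more coordinate loses at most `C(ρ_j, ψ_j)` times the norm of the derivative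
in that coordinate. -/
theorem meanSq_le_add {v w : Finset (Fin d)} {j : Fin d} (hjv : j ∉ v) (hjw : j ∉ w)
    (hwv : Disjoint w v) (hs : StrongerCondition (ρ j) (ψ j)) {g k : (Fin d → ℝ) → ℝ}
    (hg : Measurable g) (hk : Measurable k)
    (hline : ∀ᵐ z : (Fin d → ℝ) × ℝ × ℝ,
      g (Function.update z.1 j z.2.1) - g (Function.update z.1 j z.2.2) =
        ∫ t in z.2.2..z.2.1, k (Function.update z.1 j t))
    (hint : ∀ᵐ x ∂mixedMeasure ρ ψ v,
      Integrable (fun y => g ((insert j w).piecewise y x)) (mixedMeasure ρ ψ ∅))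
    (hk2 : ∫⁻ x, ‖k x‖ₑ ^ 2 ∂mixedMeasure ρ ψ (insert j v) ≠ ⊤) :
    meanSq ρ ψ v w g ≤ meanSq ρ ψ v (insert j w) g +
      ENNReal.ofReal (embedConst (ρ j) (ψ j)) * meanSq ρ ψ (insert j v) w k := by
  have hmk : Measurable fun z : (Fin d → ℝ) × ℝ =>
      ‖partialMean ρ ψ w k (Function.update z.1 j z.2)‖ₑ ^ 2 :=
    ((measurable_partialMean hk).comp (measurable_update_prod j)).enorm.pow_const 2
  have hfin : meanSq ρ ψ (insert j v) w k ≠ ⊤ :=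
    ne_top_of_le_ne_top hk2 (meanSq_le hρ (Finset.disjoint_insert_right.2 ⟨hjw, hwv⟩) hk)
  rw [meanSq_insert_eq_lintegral_update hρ hjv hk] at hfin ⊢
  rw [meanSq_eq_lintegral_update hρ hjv hg, ← lintegral_const_mul' _ _ ENNReal.ofReal_ne_top,
    meanSq, ← lintegral_add_left ((measurable_partialMean hg).enorm.pow_const 2)]
  refine lintegral_mono_ae ?_
  filter_upwards [ae_partialMean_increment hρ hψ hjv hjw hwv hk hline hint hk2, hint,
    ae_lt_top hmk.lintegral_prod_right' hfin] with x hx hix hfx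
  rw [← (partialMean_insert hρ hjw hix).2]
  exact lintegral_enorm_sq_le_of_increment (hρ j) (hψ j) hs
    ((measurable_partialMean hg).comp (measurable_update _)).aestronglyMeasurable
    ((measurable_partialMean hk).comp (measurable_update _)) hfx.ne hx
end

/-! ### All coordinates, and the constant -/

section
variable {d : ℕ} {ρ ψ : Fin d → ℝ → ℝ}

theorem meanSq_empty (hρ : ∀ j, IsPosDensity (ρ j)) (v : Finset (Fin d)) (g : (Fin d → ℝ) → ℝ) :
    meanSq ρ ψ v ∅ g = ∫⁻ x, ‖g x‖ₑ ^ 2 ∂mixedMeasure ρ ψ v := by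
  have := isProbabilityMeasure_mixedMeasure_empty (ψ := ψ) hρ
  simp [meanSq, partialMean]

/-- Iterating the one-coordinate estimate: if a family `g` of functions indexed by `u ⊆ D` consists
of successive weak derivatives, then every partially averaged norm is controlled by the fully
averaged ones. The statement is proved by induction on the coordinates outside `v`, and for
fixed `v` by induction on the set `S` of coordinates which are neither differentiated nor
averaged. -/
theorem meanSq_le_sum (hρ : ∀ j, IsPosDensity (ρ j)) (hψ : ∀ j, IsDerivWeight (ψ j))
    (hs : ∀ j, StrongerCondition (ρ j) (ψ j)) {g : Finset (Fin d) → (Fin d → ℝ) → ℝ}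
    (hg : ∀ v, Measurable (g v))
    (hline : ∀ v j, j ∉ v → ∀ᵐ z : (Fin d → ℝ) × ℝ × ℝ,
      g v (Function.update z.1 j z.2.1) - g v (Function.update z.1 j z.2.2) =
        ∫ t in z.2.2..z.2.1, g (insert j v) (Function.update z.1 j t))
    (hint : ∀ v, ∀ᵐ x ∂mixedMeasure ρ ψ v,
      Integrable (fun y => g v (vᶜ.piecewise y x)) (mixedMeasure ρ ψ ∅))
    (hfin : ∀ v, meanSq ρ ψ v vᶜ (g v) ≠ ⊤) (v : Finset (Fin d)) :
    ∀ S : Finset (Fin d), Disjoint S v → meanSq ρ ψ v (v ∪ S)ᶜ (g v) ≤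
      ∑ s ∈ S.powerset, (∏ j ∈ s, ENNReal.ofReal (embedConst (ρ j) (ψ j))) *
        meanSq ρ ψ (v ∪ s) (v ∪ s)ᶜ (g (v ∪ s)) := by
  induction hn : vᶜ.card using Nat.strong_induction_on generalizing v with
  | _ n ih =>
  intro S
  induction S using Finset.induction_on with
  | empty => intro _; simp
  | insert j S hjS ihS =>
    intro hd
    obtain ⟨hjv, hd⟩ := Finset.disjoint_insert_left.1 hd
    have hlt : (insert j v)ᶜ.card < n := by
      rw [← hn]
      refine Finset.card_lt_card (Finset.compl_ssubset_compl.2 (Finset.ssubset_insert hjv))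
    have ihv := ih _ hlt (insert j v) rfl
    -- Square integrability of the next derivative is the outer induction hypothesis, with nothing
    -- averaged.
    have hk2 : ∫⁻ x, ‖g (insert j v) x‖ₑ ^ 2 ∂mixedMeasure ρ ψ (insert j v) ≠ ⊤ := by
      have h := ihv (insert j v)ᶜ disjoint_compl_left
      rw [Finset.union_compl, Finset.compl_univ, meanSq_empty hρ] at h
      refine ne_top_of_le_ne_top (ENNReal.sum_ne_top.2 fun s _ => ENNReal.mul_ne_top ?_ (hfin _)) h
      exact ENNReal.prod_ne_top fun j _ => ENNReal.ofReal_ne_top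
    have hjw : j ∉ (v ∪ insert j S)ᶜ := by simp
    have hwv : Disjoint (v ∪ insert j S)ᶜ v :=
      disjoint_compl_left.mono_right Finset.subset_union_left
    have hins : insert j (v ∪ insert j S)ᶜ = (v ∪ S)ᶜ := by
      ext i
      by_cases hi : i = j
      · subst hi; simp [hjv, hjS]
      · simp [hi]
    have hins' : v ∪ insert j S = insert j v ∪ S := by
      rw [Finset.union_insert, Finset.insert_union]
    have hint' := ae_integrable_piecewise_of_compl hρ
      (disjoint_compl_left.mono_right Finset.subset_union_left : Disjoint (v ∪ S)ᶜ v)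
      (hg v) (hint v)
    have step := meanSq_le_add hρ hψ hjv hjw hwv (hs j) (hg v) (hg (insert j v)) (hline v j hjv)
      (by rw [hins]; exact hint') hk2
    rw [hins] at step
    refine step.trans ?_
    rw [Finset.sum_powerset_insert hjS]
    refine add_le_add (ihS hd) ?_
    rw [hins']
    refine (mul_le_mul_right (ihv S (Finset.disjoint_insert_right.2 ⟨hjS, hd⟩)) _).trans ?_
    rw [Finset.mul_sum]
    refine Finset.sum_le_sum fun s hs => ?_
    have hjs : j ∉ s := fun h => hjS (Finset.mem_powerset.1 hs h)
    rw [Finset.prod_insert hjs, ← mul_assoc, Finset.union_insert, Finset.insert_union]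

end

theorem sum_sum_powerset_compl {ι M : Type*} [Fintype ι] [DecidableEq ι] [AddCommMonoid M]
    (F : Finset ι → Finset ι → M) :
    ∑ v, ∑ s ∈ vᶜ.powerset, F v s = ∑ u, ∑ s ∈ u.powerset, F (u \ s) s := by
  rw [Finset.sum_sigma', Finset.sum_sigma']
  refine Finset.sum_bij' (fun p _ => ⟨p.1 ∪ p.2, p.2⟩) (fun p _ => ⟨p.1 \ p.2, p.2⟩) ?_ ?_ ?_ ?_ ?_
  · rintro ⟨v, s⟩ _
    simp only [Finset.mem_sigma, Finset.mem_univ, Finset.mem_powerset, true_and]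
    exact Finset.subset_union_right
  · rintro ⟨u, s⟩ _
    simp only [Finset.mem_sigma, Finset.mem_univ, Finset.mem_powerset, true_and]
    intro i hi; simp [hi]
  · rintro ⟨v, s⟩ h
    simp only [Finset.mem_sigma, Finset.mem_univ, Finset.mem_powerset, true_and] at h
    have : (v ∪ s) \ s = v := Finset.union_sdiff_cancel_right
      (Finset.disjoint_left.2 fun i hi hs => Finset.mem_compl.1 (h hs) hi)
    simp [this]
  · rintro ⟨u, s⟩ h
    simp only [Finset.mem_sigma, Finset.mem_univ, Finset.mem_powerset, true_and] at h
    simp [Finset.sdiff_union_of_subset h]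
  · rintro ⟨v, s⟩ h
    simp only [Finset.mem_sigma, Finset.mem_univ, Finset.mem_powerset, true_and] at h
    have : (v ∪ s) \ s = v := Finset.union_sdiff_cancel_right
      (Finset.disjoint_left.2 fun i hi hs => Finset.mem_compl.1 (h hs) hi)
    simp [this]

theorem equivConst_prod {d : ℕ} {ρ ψ : Fin d → ℝ → ℝ} {γ : Finset (Fin d) → ℝ}
    (hρ : ∀ j, IsPosDensity (ρ j)) (hψ : ∀ j, IsDerivWeight (ψ j)) {γ₁ : Fin d → ℝ}
    (h0 : ∀ j, 0 < γ₁ j) (h : ∀ u, γ u = ∏ j ∈ u, γ₁ j) :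
    equivConst ρ ψ γ = ∏ j, (1 + γ₁ j * embedConst (ρ j) (ψ j)) := by
  have hC : ∀ j, 0 ≤ γ₁ j * embedConst (ρ j) (ψ j) := fun j =>
    mul_nonneg (h0 j).le ((hρ j).embedConst_nonneg (hψ j))
  have hv : ∀ v : Finset (Fin d), ∑ w ∈ v.powerset, γ v / γ (v \ w) *
      ∏ j ∈ w, embedConst (ρ j) (ψ j) = ∏ j ∈ v, (1 + γ₁ j * embedConst (ρ j) (ψ j)) := fun v => by
    rw [Finset.prod_one_add]
    refine Finset.sum_congr rfl fun w hw => ?_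
    have hne : ∏ j ∈ v \ w, γ₁ j ≠ 0 := Finset.prod_ne_zero_iff.2 fun j _ => (h0 j).ne'
    rw [h, h, Finset.prod_mul_distrib, ← Finset.prod_sdiff (Finset.mem_powerset.1 hw),
      mul_div_cancel_left₀ _ hne]
  simp only [equivConst, hv]
  refine le_antisymm (Finset.sup'_le _ _ fun v _ => ?_) ?_
  · rw [← Finset.prod_mul_prod_compl v]
    refine le_mul_of_one_le_right (Finset.prod_nonneg fun j _ => add_nonneg zero_le_one (hC j)) ?_
    exact Finset.one_le_prod fun j _ => le_add_of_nonneg_right (hC j)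
  · exact Finset.le_sup' (fun v : Finset (Fin d) =>
      ∏ j ∈ v, (1 + γ₁ j * embedConst (ρ j) (ψ j))) (Finset.mem_univ Finset.univ)

/-- The bookkeeping with the weights `γ`: summing the estimates for the individual derivatives
produces the constant `equivConst`. -/
theorem sum_mul_sum_powerset_compl_le {d : ℕ} {ρ ψ : Fin d → ℝ → ℝ} {γ : Finset (Fin d) → ℝ}
    (hρ : ∀ j, IsPosDensity (ρ j)) (hψ : ∀ j, IsDerivWeight (ψ j)) (hγ : ∀ u, 0 < γ u)
    (E : Finset (Fin d) → ℝ≥0∞) :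
    ∑ v, ENNReal.ofReal (1 / γ v) * ∑ s ∈ vᶜ.powerset,
      (∏ j ∈ s, ENNReal.ofReal (embedConst (ρ j) (ψ j))) * E (v ∪ s) ≤
      ENNReal.ofReal (equivConst ρ ψ γ) * ∑ u, ENNReal.ofReal (1 / γ u) * E u := by
  have hC : ∀ j, 0 ≤ embedConst (ρ j) (ψ j) := fun j => (hρ j).embedConst_nonneg (hψ j)
  simp_rw [Finset.mul_sum]
  rw [sum_sum_powerset_compl fun v s => ENNReal.ofReal (1 / γ v) *
    ((∏ j ∈ s, ENNReal.ofReal (embedConst (ρ j) (ψ j))) * E (v ∪ s))]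
  refine Finset.sum_le_sum fun u _ => ?_
  have hu : ∑ w ∈ u.powerset, γ u / γ (u \ w) * ∏ j ∈ w, embedConst (ρ j) (ψ j) ≤
      equivConst ρ ψ γ := Finset.le_sup' (fun v : Finset (Fin d) => ∑ w ∈ v.powerset,
        γ v / γ (v \ w) * ∏ j ∈ w, embedConst (ρ j) (ψ j)) (Finset.mem_univ u)
  refine le_trans (le_of_eq ?_) (mul_le_mul_left (ENNReal.ofReal_le_ofReal hu) _)
  rw [ENNReal.ofReal_sum_of_nonneg fun w _ => mul_nonneg (div_pos (hγ _) (hγ _)).le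
    (Finset.prod_nonneg fun j _ => hC j), Finset.sum_mul]
  refine Finset.sum_congr rfl fun s hs => ?_
  rw [Finset.sdiff_union_of_subset (Finset.mem_powerset.1 hs), ← mul_assoc, ← mul_assoc,
    ← ENNReal.ofReal_prod_of_nonneg fun j _ => hC j, ← ENNReal.ofReal_mul (one_div_pos.2 (hγ _)).le,
    ← ENNReal.ofReal_mul (mul_nonneg (div_pos (hγ _) (hγ _)).le
      (Finset.prod_nonneg fun j _ => hC j))]
  congr 2
  have := (hγ u).ne'
  field_simp

/-! ### The norms as integrals against product measures -/

section
variable {d : ℕ} {ρ ψ : Fin d → ℝ → ℝ} {f : (Fin d → ℝ) → ℝ}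

theorem glue_restrict (u : Finset (Fin d)) (x y : Fin d → ℝ) :
    glue u (fun i => x i) (fun i => y i) = uᶜ.piecewise y x := by
  ext i
  by_cases hi : i ∈ u <;> simp [glue, hi]

theorem measurePreserving_glue (u : Finset (Fin d)) :
    MeasurePreserving (fun z : ({j // j ∈ u} → ℝ) × ({j // j ∉ u} → ℝ) => glue u z.1 z.2)
      ((volume : Measure ({j // j ∈ u} → ℝ)).prod (volume : Measure ({j // j ∉ u} → ℝ)))
      volume := by
  have h := (measurePreserving_piEquivPiSubtypeProd (fun _ : Fin d => (volume : Measure ℝ))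
    (· ∈ u)).symm (MeasurableEquiv.piEquivPiSubtypeProd (fun _ : Fin d => ℝ) (· ∈ u))
  have e : (fun z : ({j // j ∈ u} → ℝ) × ({j // j ∉ u} → ℝ) => glue u z.1 z.2) =
      (MeasurableEquiv.piEquivPiSubtypeProd (fun _ : Fin d => ℝ) (· ∈ u)).symm := rfl
  rw [e]
  simp only [volume_pi]
  convert h <;> rfl

theorem lintegral_mul_prod_eq_lintegral_mixedMeasure (hρ : ∀ j, IsPosDensity (ρ j))
    (hψ : ∀ j, IsDerivWeight (ψ j)) (u : Finset (Fin d)) (h : (Fin d → ℝ) → ℝ) :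
    ∫⁻ x : Fin d → ℝ, ENNReal.ofReal (|h x| ^ 2 * (∏ j ∈ u, ψ j (x j)) * ∏ j ∈ uᶜ, ρ j (x j)) =
      ∫⁻ x, ‖h x‖ₑ ^ 2 ∂mixedMeasure ρ ψ u := by
  have hm : AEMeasurable fun x : Fin d → ℝ => (∏ j ∈ u, ψ j (x j)) * ∏ j ∈ uᶜ, ρ j (x j) := by
    refine AEMeasurable.mul (Finset.aemeasurable_fun_prod _ fun j _ => ?_)
      (Finset.aemeasurable_fun_prod _ fun j _ => ?_)
    · exact (hψ j).aemeasurable.comp_quasiMeasurePreserving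
        (Measure.quasiMeasurePreserving_eval (fun _ => volume) j)
    · exact (hρ j).integrable.aestronglyMeasurable.aemeasurable.comp_quasiMeasurePreserving
        (Measure.quasiMeasurePreserving_eval (fun _ => volume) j)
  rw [mixedMeasure_eq_withDensity hρ hψ, lintegral_withDensity_eq_lintegral_mul_non_measurable₀ _
    hm.ennreal_ofReal (ae_of_all _ fun x => ENNReal.ofReal_lt_top)]
  congr 1; ext x
  rw [Pi.mul_apply, mul_assoc, mul_comm, ENNReal.ofReal_mul, sq_abs, ofReal_sq_eq_enorm_sq]
  exact mul_nonneg (Finset.prod_nonneg fun j _ => ((hψ j).pos _).le)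
    (Finset.prod_nonneg fun j _ => ((hρ j).pos _).le)

/-- The product of the densities `ρ_j` over the coordinates outside `u`. -/
def complDensityMeasure (ρ : Fin d → ℝ → ℝ) (u : Finset (Fin d)) : Measure ({j // j ∉ u} → ℝ) :=
  Measure.pi fun i => densityMeasure (ρ i)

/-- The product of the weights `ψ_j` over the coordinates in `u`. -/
def weightMeasure (ψ : Fin d → ℝ → ℝ) (u : Finset (Fin d)) : Measure ({j // j ∈ u} → ℝ) :=
  Measure.pi fun i => densityMeasure (ψ i)

theorem measurePreserving_restrict_compl (hρ : ∀ j, IsPosDensity (ρ j)) (u : Finset (Fin d)) :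
    MeasurePreserving (fun (y : Fin d → ℝ) (i : {j // j ∉ u}) => y i) (mixedMeasure ρ ψ ∅)
      (complDensityMeasure ρ u) := by
  have h := measurePreserving_subtype_restrict
    (fun j => densityMeasure (if j ∈ (∅ : Finset (Fin d)) then ψ j else ρ j)) (fun j => j ∉ u)
    (fun j _ => by simpa using (hρ j).isProbabilityMeasure)
  simpa [complDensityMeasure, mixedMeasure] using h

theorem measurePreserving_restrict (hρ : ∀ j, IsPosDensity (ρ j)) (u : Finset (Fin d)) :
    MeasurePreserving (fun (x : Fin d → ℝ) (i : {j // j ∈ u}) => x i) (mixedMeasure ρ ψ u)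
      (weightMeasure ψ u) := by
  have h := measurePreserving_subtype_restrict
    (fun j => densityMeasure (if j ∈ u then ψ j else ρ j)) (fun j => j ∈ u)
    (fun j hj => by simpa [hj] using (hρ j).isProbabilityMeasure)
  have e : (fun i : {j // j ∈ u} => densityMeasure (if (i : Fin d) ∈ u then ψ i else ρ i)) =
      fun i : {j // j ∈ u} => densityMeasure (ψ i) := funext fun i => by simp [i.2]
  rw [e] at h
  unfold weightMeasure mixedMeasure
  convert h

theorem complDensityMeasure_eq (hρ : ∀ j, IsPosDensity (ρ j)) (u : Finset (Fin d)) :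
    complDensityMeasure ρ u = volume.withDensity fun z =>
      ENNReal.ofReal (∏ j : {j // j ∉ u}, ρ j (z j)) :=
  pi_withDensity_ofReal (f := fun j : {j // j ∉ u} => ρ j)
    (fun j => (hρ j).integrable.aestronglyMeasurable.aemeasurable) fun j x => ((hρ j).pos x).le

theorem weightMeasure_eq (hψ : ∀ j, IsDerivWeight (ψ j)) (u : Finset (Fin d)) :
    weightMeasure ψ u = volume.withDensity fun z =>
      ENNReal.ofReal (∏ j : {j // j ∈ u}, ψ j (z j)) :=
  pi_withDensity_ofReal (f := fun j : {j // j ∈ u} => ψ j)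
    (fun j => (hψ j).aemeasurable) fun j x => ((hψ j).pos x).le

theorem aemeasurable_prod_density {u : Finset (Fin d)} (hρ : ∀ j, IsPosDensity (ρ j)) :
    AEMeasurable fun z : {j // j ∉ u} → ℝ => ∏ j : {j // j ∉ u}, ρ j (z j) :=
  Finset.aemeasurable_fun_prod _ fun j _ =>
    (hρ j).integrable.aestronglyMeasurable.aemeasurable.comp_quasiMeasurePreserving
      (Measure.quasiMeasurePreserving_eval (fun _ => volume) j)

theorem aemeasurable_prod_weight {u : Finset (Fin d)} (hψ : ∀ j, IsDerivWeight (ψ j)) :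
    AEMeasurable fun z : {j // j ∈ u} → ℝ => ∏ j : {j // j ∈ u}, ψ j (z j) :=
  Finset.aemeasurable_fun_prod _ fun j _ => (hψ j).aemeasurable.comp_quasiMeasurePreserving
      (Measure.quasiMeasurePreserving_eval (fun _ => volume) j)

theorem integral_mul_prod_eq (hρ : ∀ j, IsPosDensity (ρ j)) (u : Finset (Fin d))
    (h : ({j // j ∉ u} → ℝ) → ℝ) :
    ∫ z, h z * ∏ j : {j // j ∉ u}, ρ j (z j) = ∫ z, h z ∂complDensityMeasure ρ u := by
  rw [complDensityMeasure_eq hρ, integral_withDensity_eq_integral_toReal_smul₀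
    (aemeasurable_prod_density hρ).ennreal_ofReal (ae_of_all _ fun x => ENNReal.ofReal_lt_top)]
  congr 1; ext z
  rw [ENNReal.toReal_ofReal (Finset.prod_nonneg fun (j : {j // j ∉ u}) _ =>
    ((hρ j).pos _).le), smul_eq_mul, mul_comm]

theorem integrable_mul_prod_iff (hρ : ∀ j, IsPosDensity (ρ j)) (u : Finset (Fin d))
    (h : ({j // j ∉ u} → ℝ) → ℝ) :
    Integrable (fun z => h z * ∏ j : {j // j ∉ u}, ρ j (z j)) ↔
      Integrable h (complDensityMeasure ρ u) := by
  rw [complDensityMeasure_eq hρ, integrable_withDensity_iff_integrable_smul₀'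
    (aemeasurable_prod_density hρ).ennreal_ofReal (ae_of_all _ fun x => ENNReal.ofReal_lt_top)]
  refine iff_of_eq (congrArg (fun F => Integrable F volume) ?_)
  ext z
  rw [ENNReal.toReal_ofReal (Finset.prod_nonneg fun (j : {j // j ∉ u}) _ =>
    ((hρ j).pos _).le), smul_eq_mul, mul_comm]

theorem ae_innerIntegrand_eq {u : Finset (Fin d)} {g : (Fin d → ℝ) → ℝ}
    (hg : weakDeriv u f =ᵐ[volume] g) : ∀ᵐ y : {j // j ∈ u} → ℝ,
      innerIntegrand ρ u f y =ᵐ[volume] fun z =>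
        g (glue u y z) * ∏ j : {j // j ∉ u}, ρ j (z j) := by
  have h := Measure.ae_ae_of_ae_prod ((measurePreserving_glue u).quasiMeasurePreserving.ae hg)
  filter_upwards [h] with y hy
  filter_upwards [hy] with z hz
  rw [innerIntegrand, hz]

theorem measurable_glue (u : Finset (Fin d)) : Measurable
    fun z : ({j // j ∈ u} → ℝ) × ({j // j ∉ u} → ℝ) => glue u z.1 z.2 :=
  (measurePreserving_glue u).measurable

/-- The hypothesis on inner integrals in the definition of `spaceW`, in terms of resampled
points. -/
theorem ae_integrable_innerIntegrand_iff (hρ : ∀ j, IsPosDensity (ρ j))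
    (hψ : ∀ j, IsDerivWeight (ψ j)) {u : Finset (Fin d)} {g : (Fin d → ℝ) → ℝ} (hgm : Measurable g)
    (hg : weakDeriv u f =ᵐ[volume] g) :
    (∀ᵐ y : {j // j ∈ u} → ℝ, Integrable (innerIntegrand ρ u f y)) ↔
      ∀ᵐ x ∂mixedMeasure ρ ψ u,
        Integrable (fun y => g (uᶜ.piecewise y x)) (mixedMeasure ρ ψ ∅) := by
  have : SigmaFinite (complDensityMeasure ρ u) := by unfold complDensityMeasure; infer_instance
  have hS : MeasurableSet {y | Integrable (fun z => g (glue u y z)) (complDensityMeasure ρ u)} :=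
    measurableSet_integrable (hgm.comp (measurable_glue u)).stronglyMeasurable
  have h1 : (∀ᵐ y : {j // j ∈ u} → ℝ, Integrable (innerIntegrand ρ u f y)) ↔
      ∀ᵐ y : {j // j ∈ u} → ℝ, Integrable (fun z => g (glue u y z)) (complDensityMeasure ρ u) := by
    refine eventually_congr ?_
    filter_upwards [ae_innerIntegrand_eq (ρ := ρ) hg] with y hy
    rw [integrable_congr hy, integrable_mul_prod_iff hρ]
  have h2 : ae (volume : Measure ({j // j ∈ u} → ℝ)) = ae (weightMeasure ψ u) := by
    rw [weightMeasure_eq hψ]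
    refine le_antisymm (Measure.AbsolutelyContinuous.ae_le ?_) (Measure.AbsolutelyContinuous.ae_le
      (withDensity_absolutelyContinuous _ _))
    exact withDensity_absolutelyContinuous' (aemeasurable_prod_weight hψ).ennreal_ofReal
      (ae_of_all _ fun x => (ENNReal.ofReal_pos.2
        (Finset.prod_pos fun (j : {j // j ∈ u}) _ => (hψ j).pos _)).ne')
  have hr := measurePreserving_restrict (ψ := ψ) hρ u
  rw [h1, h2, ← hr.map_eq, ae_map_iff hr.measurable.aemeasurable hS]
  refine eventually_congr (ae_of_all _ fun x => ?_)
  have hm : Measurable fun z => g (glue u (fun i => x i) z) :=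
    hgm.comp ((measurable_glue u).comp (measurable_prodMk_left (x := fun i : {j // j ∈ u} => x i)))
  rw [← (measurePreserving_restrict_compl (ψ := ψ) hρ u).integrable_comp hm.aestronglyMeasurable]
  simp only [Function.comp_def, glue_restrict]

/-- The terms of the ANOVA norm are fully averaged norms. -/
theorem lintegral_innerIntegrand_eq_meanSq (hρ : ∀ j, IsPosDensity (ρ j))
    (hψ : ∀ j, IsDerivWeight (ψ j)) {u : Finset (Fin d)} {g : (Fin d → ℝ) → ℝ} (hgm : Measurable g)
    (hg : weakDeriv u f =ᵐ[volume] g) :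
    ∫⁻ y : {j // j ∈ u} → ℝ, ENNReal.ofReal
      (|∫ z : {j // j ∉ u} → ℝ, innerIntegrand ρ u f y z| ^ 2 * ∏ j : {j // j ∈ u}, ψ j (y j)) =
      meanSq ρ ψ u uᶜ g := by
  have : SigmaFinite (complDensityMeasure ρ u) := by unfold complDensityMeasure; infer_instance
  set I : ({j // j ∈ u} → ℝ) → ℝ := fun y => ∫ z, g (glue u y z) ∂complDensityMeasure ρ u
  have hI : Measurable I :=
    ((hgm.comp (measurable_glue u)).stronglyMeasurable.integral_prod_right').measurable
  have hc := measurePreserving_restrict_compl (ψ := ψ) hρ u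
  have h1 : ∀ x, partialMean ρ ψ uᶜ g x = I fun i => x i := fun x => by
    have hm : Measurable fun z => g (glue u (fun i => x i) z) :=
      hgm.comp ((measurable_glue u).comp
        (measurable_prodMk_left (x := fun i : {j // j ∈ u} => x i)))
    simp only [I]
    rw [← hc.map_eq, integral_map hc.measurable.aemeasurable hm.aestronglyMeasurable]
    simp only [glue_restrict, partialMean]
  have hr := measurePreserving_restrict (ψ := ψ) hρ u
  have h2 := hr.lintegral_comp (f := fun y => ‖I y‖ₑ ^ 2) (hI.enorm.pow_const 2)
  simp only [meanSq, h1]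
  rw [h2, weightMeasure_eq hψ, lintegral_withDensity_eq_lintegral_mul_non_measurable₀ _
    (aemeasurable_prod_weight hψ).ennreal_ofReal (ae_of_all _ fun x => ENNReal.ofReal_lt_top)]
  refine lintegral_congr_ae ?_
  filter_upwards [ae_innerIntegrand_eq (ρ := ρ) hg] with y hy
  rw [integral_congr_ae hy, integral_mul_prod_eq hρ, mul_comm, ENNReal.ofReal_mul
    (Finset.prod_nonneg fun (j : {j // j ∈ u}) _ => ((hψ j).pos _).le), sq_abs,
    ofReal_sq_eq_enorm_sq]
  rfl

/-- A square integrable function is integrable over almost every slice. -/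
theorem ae_integrable_piecewise_of_lintegral_ne_top (hρ : ∀ j, IsPosDensity (ρ j))
    {v w : Finset (Fin d)} (hwv : Disjoint w v) {g : (Fin d → ℝ) → ℝ} (hg : Measurable g)
    (h : ∫⁻ x, ‖g x‖ₑ ^ 2 ∂mixedMeasure ρ ψ v ≠ ⊤) :
    ∀ᵐ x ∂mixedMeasure ρ ψ v, Integrable (fun y => g (w.piecewise y x)) (mixedMeasure ρ ψ ∅) := by
  have := isProbabilityMeasure_mixedMeasure_empty (ψ := ψ) hρ
  have hm : Measurable fun x => ‖g x‖ₑ ^ 2 := hg.enorm.pow_const 2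
  have hm' := hm.comp (measurable_piecewise_prod w)
  rw [← (measurePreserving_piecewise_mixed hρ hwv).lintegral_comp hm] at h
  have h' := (lintegral_prod _ hm'.aemeasurable).symm.trans_ne h
  filter_upwards [ae_lt_top hm'.lintegral_prod_right' h'] with x hx
  exact ((memLp_two_iff_lintegral_enorm_sq (hg.comp ((measurable_piecewise_prod w).comp
    measurable_prodMk_left)).aestronglyMeasurable).2 hx).integrable one_le_two

end

/-! ### Comparison of the spaces -/

/-- The weak derivatives have measurable versions. -/
theorem exists_measurable_derivatives {d : ℕ} {f : (Fin d → ℝ) → ℝ}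
    (h : ∀ u, ∃ g, IsWeakDeriv u f g) :
    ∃ g : Finset (Fin d) → (Fin d → ℝ) → ℝ, (∀ u, Measurable (g u)) ∧
      (∀ u, weakDeriv u f =ᵐ[volume] g u) ∧ ∀ u, IsWeakDeriv u f (g u) := by
  have hm : ∀ u, AEMeasurable (weakDeriv u f) := fun u =>
    (isWeakDeriv_weakDeriv (h u)).1.aestronglyMeasurable.aemeasurable
  exact ⟨fun u => (hm u).mk _, fun u => (hm u).measurable_mk, fun u => (hm u).ae_eq_mk, fun u =>
    (isWeakDeriv_weakDeriv (h u)).congr_ae (hm u).ae_eq_mk⟩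

section
variable {d : ℕ} {ρ ψ : Fin d → ℝ → ℝ} {f : (Fin d → ℝ) → ℝ}

theorem sqNormH_eq (hρ : ∀ j, IsPosDensity (ρ j)) (hψ : ∀ j, IsDerivWeight (ψ j))
    (γ : Finset (Fin d) → ℝ) {g : Finset (Fin d) → (Fin d → ℝ) → ℝ}
    (hg : ∀ u, weakDeriv u f =ᵐ[volume] g u) :
    sqNormH ρ ψ γ f = ∑ u, ENNReal.ofReal (1 / γ u) * ∫⁻ x, ‖g u x‖ₑ ^ 2 ∂mixedMeasure ρ ψ u := by
  refine Finset.sum_congr rfl fun u _ => ?_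
  rw [lintegral_mul_prod_eq_lintegral_mixedMeasure hρ hψ]
  congr 1
  refine lintegral_congr_ae ?_
  filter_upwards [(mixedMeasure_absolutelyContinuous hρ hψ u).ae_le (hg u)] with x hx
  rw [hx]

theorem sqNormW_eq (hρ : ∀ j, IsPosDensity (ρ j)) (hψ : ∀ j, IsDerivWeight (ψ j))
    (γ : Finset (Fin d) → ℝ) {g : Finset (Fin d) → (Fin d → ℝ) → ℝ} (hgm : ∀ u, Measurable (g u))
    (hg : ∀ u, weakDeriv u f =ᵐ[volume] g u) :
    sqNormW ρ ψ γ f = ∑ u, ENNReal.ofReal (1 / γ u) * meanSq ρ ψ u uᶜ (g u) := by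
  refine Finset.sum_congr rfl fun u _ => ?_
  rw [lintegral_innerIntegrand_eq_meanSq hρ hψ (hgm u) (hg u)]

theorem sqNormW_le_sqNormH (hρ : ∀ j, IsPosDensity (ρ j)) (hψ : ∀ j, IsDerivWeight (ψ j))
    (γ : Finset (Fin d) → ℝ) (h : ∀ u, ∃ g, IsWeakDeriv u f g) :
    sqNormW ρ ψ γ f ≤ sqNormH ρ ψ γ f := by
  obtain ⟨g, hgm, hg, _⟩ := exists_measurable_derivatives h
  rw [sqNormW_eq hρ hψ γ hgm hg, sqNormH_eq hρ hψ γ hg]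
  exact Finset.sum_le_sum fun u _ => mul_le_mul_right (meanSq_le hρ disjoint_compl_left (hgm u)) _

theorem ne_top_of_sum_weight_mul_lt_top {γ : Finset (Fin d) → ℝ} (hγ : ∀ u, 0 < γ u)
    {A : Finset (Fin d) → ℝ≥0∞} (h : ∑ u, ENNReal.ofReal (1 / γ u) * A u < ⊤)
    (u : Finset (Fin d)) : A u ≠ ⊤ := by
  have h1 := ENNReal.sum_ne_top.1 h.ne u (Finset.mem_univ u)
  intro hA
  rw [hA, ENNReal.mul_top (ENNReal.ofReal_pos.2 (one_div_pos.2 (hγ u))).ne'] at h1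
  exact h1 rfl

theorem spaceH_subset_spaceW (hρ : ∀ j, IsPosDensity (ρ j)) (hψ : ∀ j, IsDerivWeight (ψ j))
    {γ : Finset (Fin d) → ℝ} (hγ : ∀ u, 0 < γ u) : spaceH ρ ψ γ ⊆ spaceW ρ ψ γ := by
  rintro f ⟨hf, hw, hn⟩
  refine ⟨hf, hw, fun u => ?_, (sqNormW_le_sqNormH hρ hψ γ hw).trans_lt hn⟩
  obtain ⟨g, hgm, hg, _⟩ := exists_measurable_derivatives hw
  rw [sqNormH_eq hρ hψ γ hg] at hn
  exact (ae_integrable_innerIntegrand_iff hρ hψ (hgm u) (hg u)).2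
    (ae_integrable_piecewise_of_lintegral_ne_top hρ disjoint_compl_left (hgm u)
      (ne_top_of_sum_weight_mul_lt_top hγ hn u))

/-- The comparison of the norms on the ANOVA space, which also shows that its elements have
finite Sobolev norm. -/
theorem sqNormH_le_of_mem_spaceW (hρ : ∀ j, IsPosDensity (ρ j)) (hψ : ∀ j, IsDerivWeight (ψ j))
    {γ : Finset (Fin d) → ℝ} (hγ : ∀ u, 0 < γ u) (hs : ∀ j, StrongerCondition (ρ j) (ψ j))
    (hf : f ∈ spaceW ρ ψ γ) :
    sqNormH ρ ψ γ f ≤ ENNReal.ofReal (equivConst ρ ψ γ) * sqNormW ρ ψ γ f := by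
  obtain ⟨_, hw, hint, hn⟩ := hf
  obtain ⟨g, hgm, hg, hgw⟩ := exists_measurable_derivatives hw
  rw [sqNormW_eq hρ hψ γ hgm hg] at hn ⊢
  rw [sqNormH_eq hρ hψ γ hg]
  refine le_trans (Finset.sum_le_sum fun v _ => mul_le_mul_right ?_ _)
    (sum_mul_sum_powerset_compl_le hρ hψ hγ fun u => meanSq ρ ψ u uᶜ (g u))
  have key := meanSq_le_sum hρ hψ hs hgm (fun v j hj =>
      ae_update_sub_update_eq_intervalIntegral j (hgm _) (hgw v).1 (hgw (insert j v)).1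
        fun φ hφ hc => (hgw v).integral_mul_eq_neg hj (hgw (insert j v)) hφ hc)
    (fun v => (ae_integrable_innerIntegrand_iff hρ hψ (hgm v) (hg v)).1 (hint v))
    (fun v => ne_top_of_sum_weight_mul_lt_top hγ hn v) v vᶜ disjoint_compl_left
  rwa [Finset.union_compl, Finset.compl_univ, meanSq_empty hρ] at key

theorem spaceW_subset_spaceH (hρ : ∀ j, IsPosDensity (ρ j)) (hψ : ∀ j, IsDerivWeight (ψ j))
    {γ : Finset (Fin d) → ℝ} (hγ : ∀ u, 0 < γ u) (hs : ∀ j, StrongerCondition (ρ j) (ψ j)) :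
    spaceW ρ ψ γ ⊆ spaceH ρ ψ γ := fun _ hf =>
  ⟨hf.1, hf.2.1, (sqNormH_le_of_mem_spaceW hρ hψ hγ hs hf).trans_lt
    (ENNReal.mul_lt_top ENNReal.ofReal_lt_top hf.2.2.2)⟩

end

end AnovaSobolev

end

theorem mainTheorem4 (d : ℕ) (hd : 1 ≤ d)
    (ρ ψ : Fin d → ℝ → ℝ) (γ : Finset (Fin d) → ℝ)
    (hρ : ∀ j, AnovaSobolev.IsPosDensity (ρ j))
    (hψ : ∀ j, AnovaSobolev.IsDerivWeight (ψ j))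
    (hγ : ∀ u, 0 < γ u)
    (hstrong : ∀ j, AnovaSobolev.StrongerCondition (ρ j) (ψ j)) :
    (∀ j, Integrable (AnovaSobolev.embedIntegrand (ρ j) (ψ j))) ∧
    AnovaSobolev.spaceH ρ ψ γ = AnovaSobolev.spaceW ρ ψ γ ∧
    (∀ f ∈ AnovaSobolev.spaceH ρ ψ γ,
      AnovaSobolev.sqNormW ρ ψ γ f ≤ AnovaSobolev.sqNormH ρ ψ γ f ∧
      AnovaSobolev.sqNormH ρ ψ γ f ≤
        ENNReal.ofReal (AnovaSobolev.equivConst ρ ψ γ) * AnovaSobolev.sqNormW ρ ψ γ f) ∧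
    (∀ γ₁ : Fin d → ℝ, (∀ j, 0 < γ₁ j) → (∀ u, γ u = ∏ j ∈ u, γ₁ j) →
      AnovaSobolev.equivConst ρ ψ γ =
        ∏ j, (1 + γ₁ j * AnovaSobolev.embedConst (ρ j) (ψ j))) :=
  have hsub := AnovaSobolev.spaceH_subset_spaceW hρ hψ hγ
  ⟨fun j => (hρ j).integrable_embedIntegrand (hψ j) (hstrong j),
    hsub.antisymm (AnovaSobolev.spaceW_subset_spaceH hρ hψ hγ hstrong),
    fun _ hf => ⟨AnovaSobolev.sqNormW_le_sqNormH hρ hψ γ hf.2.1,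
      AnovaSobolev.sqNormH_le_of_mem_spaceW hρ hψ hγ hstrong (hsub hf)⟩,
    fun _ h0 h => AnovaSobolev.equivConst_prod hρ hψ h0 h⟩
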